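/- **Setting.** Let $\mathcal M\subset\mathbb R^n$ be a compact embedded smooth submanifold with the metric induced from $\mathbb R^n$, equipped with a retraction, i.e. smooth maps $\mathrm{Retr}_z:\mathrm T_z\mathcal M\to\mathcal M$ ($z\in\mathcal M$) with $\mathrm{Retr}_z(0)=z$ and $\frac{d}{ds}\mathrm{Retr}_z(sv)|_{s=0}=v$. Let $f:\mathbb R^n\to\mathbb R$ and $c:\mathbb R^n\to\mathbb R^m$ be continuously differentiable and $h:\mathbb R^m\to\mathbb R$ convex. Suppose there are positive constants $L_f,L_h,L_c,M_1,M_2$ such that $\nabla f$ is $L_f$-Lipschitz, $h$ is $L_h$-Lipschitz, the Jacobian $\nabla c$ is $L_c$-Lipschitz in operator norm, and $\|\mathrm{Retr}_z(\xi)-z\|\le M_1\|\xi\|$, $\|\mathrm{Retr}_z(\xi)-(z+\xi)\|\le M_2\|\xi\|^2$ for all $z\in\mathcal M$, $\xi\in \mathrm T_z\mathcal M$. Put $F(z)=f(z)+h(c(z))$, $F_\star=\inf_{\mathcal M}F$, and for $t>0$ $$F(z;y)=f(y)+\nabla f(y)^\top(z-y)+h\big(c(y)+\nabla c(y)(z-y)\big),\quad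 F_t(z;y)=F(z;y)+\tfrac1{2t}\|z-y\|^2,\quad S_t(y)=\operatorname*{argmin}_{z\in y+\mathrm T_y\mathcal M}F_t(z;y).$$ A point $z\in\mathcal M$ is $\epsilon$-stationary if $\|(z-S_t(z))/t\|\le\epsilon$. Let $h_\star(\lambda)=\sup_{y}(y^\top\lambda-h(y))$ and let $D_{h_\star}$ be the diameter of $\{h_\star<\infty\}$. **Algorithm.** Fix $t>0$ and an inexact type: (LACC) with a parameter $\rho_l>0$, for which put $\rho=\rho_l$, or (HACC) with a parameter $\rho_h\in(0,1/4)$, for which put $\rho=\rho':=\rho_h/(1-2\sqrt{\rho_h})$. Let $c_0=1+1/(\sqrt{1+\rho}+\sqrt\rho)^2$. Start at any $z_0\in\mathcal M$. In main iteration $k$ let $B=\nabla c(z_k)$, $P=\mathrm{Proj}_{\mathrm T_{z_k}\mathcal M}$, $x(\lambda)=-tP(B^\top\lambda+\nabla f(z_k))$ and $D(\lambda)=f(z_k)-\frac t2\|P(B^\top\lambda+\nabla f(z_k))\|^2-h_\star(\lambda)+\lambda^\top c(z_k)$. *Subproblem solver.* Start at $\lambda_a^0=\lambda_b^0=\lambda_c^0$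 with $h_\star(\lambda_a^0)<\infty$, and $\gamma_0=1$. For $j=0,1,2,\dots$ set $$\lambda_c^{j+1}=(1-\gamma_j)\lambda_a^j+\gamma_j\lambda_b^j,\qquad g^{j+1}=tBP(B^\top\lambda_c^{j+1}+\nabla f(z_k))-c(z_k),$$ $$\lambda_b^{j+1}\in\operatorname*{argmin}_\lambda\ \tfrac{\gamma_j}{2}\,t\|BPB^\top\|\,\|\lambda-\lambda_b^j\|^2+(\lambda-\lambda_c^{j+1})^\top g^{j+1}+h_\star(\lambda)$$ (fixed step size $(t\|BPB^\top\|)^{-1}$), then $$\lambda_a^{j+1}=(1-\gamma_j)\lambda_a^j+\gamma_j\lambda_b^{j+1},\qquad \gamma_{j+1}=\frac{2}{1+\sqrt{1+4/\gamma_j^2}},\qquad \lambda_{\rm erg}^{j+1}=\frac{\sum_{i\le j}\gamma_i^{-1}\lambda_c^{i+1}}{\sum_{i\le j}\gamma_i^{-1}}.$$ With $x=x(\lambda_{\rm erg}^{j+1})$, stop as soon as $$F_t(x+z_k;z_k)-D(\lambda_a^{j+1})\le\begin{cases}\rho_l\,\big(F(z_k)-F_t(x+z_k;z_k)\big)&\text{(LACC)},\\[2pt]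 \frac{\rho_h}{2t}\|x\|^2&\text{(HACC)}.\end{cases}$$ Then $J_k:=j+1$ is the number of subproblem iterations, and $\tilde z_{k+1}:=z_k+x$. *Line search.* Set $z_{k+1}=\mathrm{Retr}_{z_k}(\alpha_k(\tilde z_{k+1}-z_k))$, where $\alpha_k$ is the largest element of $\{2^{-s}:s\in\mathbb N\}$ such that $$F(z_k)-F(z_{k+1})\ge\frac{c_0\alpha_k}{4t}\|z_k-\tilde z_{k+1}\|^2\quad\text{and}\quad\tfrac12\big(F(z_k)+F(z_k+\alpha_k(\tilde z_{k+1}-z_k);z_k)\big)\ge F(z_{k+1}).$$ **Constants.** Let $L=L_f+L_hL_c$, $G_F=\sup_{\mathcal M}\|\nabla f\|+L_h\sup_{\mathcal M}\|\nabla c\|$, $\tau=(\max\{M_1^2,1\}L)^{-1}$, and $\hat c=\min\{1,\,c_0/(2c_2)\}$ with $c_2=t/\tau+2tG_FM_2$. For a constant $C>0$ let $$j_\epsilon=\max\Big\{1,\frac1\epsilon\sqrt{\frac{2C(1+\rho_l)(\sup_{\mathcal M}\|\nabla c\|)^2D_{h_\star}^2}{\rho_l}}\Big\}\ \text{(LACC)},\qquad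 j_\epsilon=\max\Big\{1,\frac1\epsilon\sqrt{\frac{2C(1+\sqrt{\rho_h})^2(\sup_{\mathcal M}\|\nabla c\|)^2D_{h_\star}^2}{\rho_h}}\Big\}\ \text{(HACC)}.$$ **Theorem.** There is a numerical constant $C>0$ such that in every such setting, for both (LACC) and (HACC) and for every run of the algorithm, the following holds for every $\epsilon>0$. The run reaches an $\epsilon$-stationary point. If $z_{k_\epsilon}$ is the first one, then in every main iteration $k<k_\epsilon$ the subproblem solver and the line search terminate, and the total number of subproblem iterations satisfies $$J(\epsilon):=\sum_{k=0}^{k_\epsilon-1}J_k\ \le\ \left\lfloor\frac{(4+4\rho)(F(z_0)-F_\star)}{t\,\hat c\,\epsilon^2}\right\rfloor\lfloor j_\epsilon\rfloor .$$ Moreover $j_\epsilon=O(1/\epsilon)$ as $\epsilon\downarrow0$, and there is a constant $K$, depending on the problem data, $t$ and the inexact type with its parameter but not on the run or on $\epsilon$, such that $J(\epsilon)\le K/\epsilon^3$ for all $\epsilon\in(0,1]$. -/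

import Mathlib

open scoped Manifold ContDiff RealInnerProductSpace

noncomputable section

namespace IManPL

/-- Euclidean space `ℝⁿ` with its standard inner product and norm. -/
abbrev E (n : ℕ) : Type := EuclideanSpace ℝ (Fin n)

/-- The tangent space at `z` of a submanifold `M` of `ℝⁿ`, as a linear subspace of `ℝⁿ`:
the range of the differential of the inclusion. -/
def tangentSpaceOf {n : ℕ} (d : ℕ) (M : Set (E n)) [ChartedSpace (E d) M] (z : M) :
    Submodule ℝ (E n) :=
  LinearMap.range (mvfderiv (𝓡 d) (Subtype.val : M → E n) z).toLinearMap

/-- The data of `min_{z ∈ M} f z + h (c z)`: the three functions, a `d`-dimensional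
embedded submanifold `M` of `ℝⁿ`, and a retraction on `M`. -/
structure CompositeProblem (n m d : ℕ) where
  f : E n → ℝ
  c : E n → E m
  h : E m → ℝ
  M : Set (E n)
  charted : ChartedSpace (E d) M
  manifold : IsManifold (𝓡 d) ∞ M
  embedded : Manifold.IsSmoothEmbedding (𝓡 d) 𝓘(ℝ, E n) ∞ (Subtype.val : M → E n)
  retr : (z : M) → tangentSpaceOf d M z → M
  retr_smooth : ∀ z : M, ContMDiff 𝓘(ℝ, tangentSpaceOf d M z) (𝓡 d) ∞ (retr z)
  retr_zero : ∀ z : M, retr z 0 = z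
  retr_deriv : ∀ (z : M) (v : tangentSpaceOf d M z),
    HasDerivAt (fun s : ℝ => (retr z (s • v) : E n)) (v : E n) 0

attribute [instance] CompositeProblem.charted CompositeProblem.manifold

namespace CompositeProblem

variable {n m d : ℕ} (P : CompositeProblem n m d)

/-- `T_z M`. -/
abbrev T (z : P.M) : Submodule ℝ (E n) := tangentSpaceOf d P.M z

/-- The objective `F(z) = f(z) + h(c(z))`. -/
def F (z : E n) : ℝ := P.f z + P.h (P.c z)

/-- The partial linearization
`F(z; y) = f(y) + ∇f(y)ᵀ(z - y) + h(c(y) + ∇c(y)(z - y))`. -/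
def Flin (z y : E n) : ℝ :=
  P.f y + ⟪gradient P.f y, z - y⟫ + P.h (P.c y + fderiv ℝ P.c y (z - y))

/-- `F_t(z; y) = F(z; y) + ‖z - y‖² / (2t)`. -/
def Fprox (t : ℝ) (z y : E n) : ℝ := P.Flin z y + 1 / (2 * t) * ‖z - y‖ ^ 2

/-- `s = S_t(y)`, i.e. `s` minimizes `F_t(·; y)` over `T_y M + y`. -/
def IsProxPoint (t : ℝ) (y : P.M) (s : E n) : Prop :=
  s - y ∈ P.T y ∧ ∀ z : E n, z - y ∈ P.T y → P.Fprox t s y ≤ P.Fprox t z y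

/-- `z` is an `ε`-stationary point: `‖(z - S_t(z)) / t‖ ≤ ε`. -/
def IsEpsStationary (t ε : ℝ) (z : P.M) : Prop :=
  ∃ s, P.IsProxPoint t z s ∧ ‖(1 / t) • ((z : E n) - s)‖ ≤ ε

/-- The standing assumption, with its constants. -/
structure Assumption (Lf Lh Lc M₁ M₂ : ℝ) : Prop where
  Lf_pos : 0 < Lf
  Lh_pos : 0 < Lh
  Lc_pos : 0 < Lc
  M₁_pos : 0 < M₁
  M₂_pos : 0 < M₂
  f_smooth : ContDiff ℝ 1 P.f
  f_lip : ∀ z z', ‖gradient P.f z - gradient P.f z'‖ ≤ Lf * ‖z - z'‖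
  h_convex : ConvexOn ℝ Set.univ P.h
  h_lip : ∀ y y', |P.h y - P.h y'| ≤ Lh * ‖y - y'‖
  c_smooth : ContDiff ℝ 1 P.c
  c_lip : ∀ z z', ‖fderiv ℝ P.c z - fderiv ℝ P.c z'‖ ≤ Lc * ‖z - z'‖
  compact : IsCompact P.M
  retr_bound₁ : ∀ (z : P.M) (ξ : P.T z), ‖(P.retr z ξ : E n) - z‖ ≤ M₁ * ‖ξ‖
  retr_bound₂ : ∀ (z : P.M) (ξ : P.T z),
    ‖(P.retr z ξ : E n) - ((z : E n) + (ξ : E n))‖ ≤ M₂ * ‖ξ‖ ^ 2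

/-- `sup_{z ∈ M} ‖∇c(z)‖₂` (operator norm). -/
def supGradC : ℝ := ⨆ z : P.M, ‖fderiv ℝ P.c z‖

/-- `G_F = sup_{z ∈ M} ‖∇f(z)‖ + L_h sup_{z ∈ M} ‖∇c(z)‖`. -/
def GF (Lh : ℝ) : ℝ := (⨆ z : P.M, ‖gradient P.f z‖) + Lh * P.supGradC

/-- `F_⋆ = inf_{z ∈ M} F(z)`. -/
def Fstar : ℝ := ⨅ z : P.M, P.F z

/-- The convex conjugate `h_⋆(λ) = sup_y (yᵀλ - h(y))`, with values in `[-∞, ∞]`. -/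
def conj (l : E m) : EReal := ⨆ y : E m, ((⟪y, l⟫ - P.h y : ℝ) : EReal)

/-- `D_{h_⋆}`, the diameter of the effective domain of `h_⋆`. -/
def conjDiam : ℝ := Metric.diam {l : E m | P.conj l < ⊤}

/-! ### The dual of the subproblem at `z ∈ M`

`B = ∇c(z)`, and the orthogonal projection of `ℝⁿ` onto `T_z M` is `I - CᵀC` for any matrix `C`
with orthonormal rows and kernel `T_z M`. -/

/-- `B = ∇c(z)`. -/
def B (z : P.M) : E n →L[ℝ] E m := fderiv ℝ P.c z

/-- `x(λ) = -t (I - CᵀC)(Bᵀλ + ∇f(z))`, as an element of `T_z M`. -/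
def primal (t : ℝ) (z : P.M) (l : E m) : P.T z :=
  -(t • (P.T z).orthogonalProjectionOnto
    (ContinuousLinearMap.adjoint (P.B z) l + gradient P.f z))

/-- The dual function
`D(λ) = f(z) - (t/2) (Bᵀλ + ∇f(z))ᵀ(I - CᵀC)(Bᵀλ + ∇f(z)) - h_⋆(λ) + λᵀc(z)`. -/
def dual (t : ℝ) (z : P.M) (l : E m) : EReal :=
  ((P.f z - t / 2 * ⟪ContinuousLinearMap.adjoint (P.B z) l + gradient P.f z,
      (P.T z).starProjection (ContinuousLinearMap.adjoint (P.B z) l + gradient P.f z)⟫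
    + ⟪l, P.c z⟫ : ℝ) : EReal) - P.conj l

/-- `B (I - CᵀC) Bᵀ`. -/
def dualHess (z : P.M) : E m →L[ℝ] E m :=
  P.B z ∘L (P.T z).starProjection ∘L ContinuousLinearMap.adjoint (P.B z)

/-- The fixed step size `(t ‖B (I - CᵀC) Bᵀ‖)⁻¹` of the dual solver. If `B (I - CᵀC) Bᵀ = 0`
this is an infinite step; then the value is `0`, and since `x / 0 = 0` the proximal term
`γ / (2 * step) * ‖·‖²` below vanishes, as it should. -/
def step (t : ℝ) (z : P.M) : ℝ := (t * ‖P.dualHess z‖)⁻¹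

/-- The gradient `t B (I - CᵀC)(Bᵀλ + ∇f(z)) - c(z)` of the smooth part of `-D`. -/
def dualGrad (t : ℝ) (z : P.M) (l : E m) : E m :=
  t • P.B z ((P.T z).starProjection
    (ContinuousLinearMap.adjoint (P.B z) l + gradient P.f z)) - P.c z

end CompositeProblem

/-- `γ₀ = 1`, `γ_{j+1} = 2 / (1 + √(1 + 4 / γ_j²))`. -/
def gam : ℕ → ℝ
  | 0 => 1
  | j + 1 => 2 / (1 + √(1 + 4 / gam j ^ 2))

/-- The ergodic average
`λ_{c,erg}^j = (∑_{i<j} γ_i⁻¹ λ_c^{i+1}) / (∑_{i<j} γ_i⁻¹)` for `j ≥ 1`. -/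
def erg {m : ℕ} (lc : ℕ → E m) (j : ℕ) : E m :=
  (∑ i ∈ Finset.range j, (gam i)⁻¹)⁻¹ • ∑ i ∈ Finset.range j, (gam i)⁻¹ • lc (i + 1)

/-- The inexact type, with its parameter. -/
inductive InexactType
  | lacc (ρ : ℝ)
  | hacc (ρ : ℝ)

namespace InexactType

/-- `ρ_l` for the low accuracy condition, `ρ' = ρ_h / (1 - 2√ρ_h)` for the high accuracy one. -/
def rho : InexactType → ℝ
  | lacc ρ => ρ
  | hacc ρ => ρ / (1 - 2 * √ρ)

/-- The admissible parameters: `ρ_l > 0`, `ρ_h ∈ (0, 1/4)`. -/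
def Valid : InexactType → Prop
  | lacc ρ => 0 < ρ
  | hacc ρ => 0 < ρ ∧ ρ < 1 / 4

/-- `c₀ = 1 + 1 / (√(1+ρ) + √ρ)²`, with `ρ = ρ_l` or `ρ = ρ'`. -/
def c₀ (it : InexactType) : ℝ := 1 + 1 / (√(1 + it.rho) + √it.rho) ^ 2

end InexactType

namespace CompositeProblem

variable {n m d : ℕ} (P : CompositeProblem n m d)

/-- The iterates of the accelerated proximal gradient method for minimizing `-D` at `z`,
continued without a stopping rule: `la`, `lb`, `lc` are `λ_a`, `λ_b`, `λ_c`. -/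
structure IsAPG (t : ℝ) (z : P.M) (la lb lc : ℕ → E m) : Prop where
  init_dom : P.conj (la 0) < ⊤
  init_b : lb 0 = la 0
  init_c : lc 0 = la 0
  step_c : ∀ j, lc (j + 1) = (1 - gam j) • la j + gam j • lb j
  step_b : ∀ j, IsMinOn
    (fun l : E m => ((gam j / (2 * P.step t z) * ‖l - lb j‖ ^ 2
      + ⟪l - lc (j + 1), P.dualGrad t z (lc (j + 1))⟫ : ℝ) : EReal) + P.conj l)
    Set.univ (lb (j + 1))
  step_a : ∀ j, la (j + 1) = (1 - gam j) • la j + gam j • lb (j + 1)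

/-- The stopping criterion of the dual solver, for the primal candidate `x(lerg)` and the
dual candidate `la`. -/
def Stop (t : ℝ) (it : InexactType) (z : P.M) (la lerg : E m) : Prop :=
  ((P.Fprox t ((P.primal t z lerg : E n) + z) z : ℝ) : EReal) - P.dual t z la ≤
    ((match it with
      | .lacc ρ => ρ * (P.F z - P.Fprox t ((P.primal t z lerg : E n) + z) z)
      | .hacc ρ => ρ / (2 * t) * ‖P.primal t z lerg‖ ^ 2 : ℝ) : EReal)

/-- The dual solver with iterates `la`, `lc` stops after exactly `J` iterations. -/
def StopsAfter (t : ℝ) (it : InexactType) (z : P.M) (la lc : ℕ → E m) (J : ℕ) : Prop :=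
  IsLeast {j | 1 ≤ j ∧ P.Stop t it z (la j) (erg lc j)} J

/-- The two line search conditions for the direction `v = z̃ - z` and shrinkage factor `α`. -/
def LineSearchOK (t : ℝ) (it : InexactType) (z : P.M) (v : P.T z) (α : ℝ) : Prop :=
  P.F z - P.F (P.retr z (α • v)) ≥ it.c₀ * α / (4 * t) * ‖v‖ ^ 2 ∧
  1 / 2 * (P.F z + P.Flin ((z : E n) + α • (v : E n)) z) - P.F (P.retr z (α • v)) ≥ 0

/-- The backtracking line search accepts the factor `2⁻ˢ`, i.e. `2⁻ˢ` is the largest admissible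
value in `{2⁻ˢ : s ∈ ℕ}`. -/
def Accepts (t : ℝ) (it : InexactType) (z : P.M) (v : P.T z) (s : ℕ) : Prop :=
  IsLeast {s : ℕ | P.LineSearchOK t it z v ((1 / 2) ^ s)} s

/-- A run of IManPL with step size `t`: `z k` are the main iterates, and `la k`, `lb k`, `lc k`
those of the dual solver at `z k`. It is not part of the definition that the dual solver or the
line search terminates: if one of them does not, the run gets stuck at `z k`, and the values
`z (k + 1), …` are meaningless (arbitrary). -/
structure IsRun (t : ℝ) (it : InexactType) (z : ℕ → P.M) (la lb lc : ℕ → ℕ → E m) : Prop where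
  apg : ∀ k, P.IsAPG t (z k) (la k) (lb k) (lc k)
  update : ∀ k J s,
    P.StopsAfter t it (z k) (la k) (lc k) J →
    P.Accepts t it (z k) (P.primal t (z k) (erg (lc k) J)) s →
    z (k + 1) = P.retr (z k) (((1 / 2 : ℝ) ^ s) • P.primal t (z k) (erg (lc k) J))

/-- `J(ε) = N`: the run reaches an `ε`-stationary point, the first one being `z kε`; in every main
iteration `k < kε` the dual solver stops, after `J k` iterations, and the line search terminates;
and `∑_{k < kε} J k = N`. -/
def TotalSubIterations (t : ℝ) (it : InexactType) (z : ℕ → P.M) (la lc : ℕ → ℕ → E m)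
    (ε : ℝ) (N : ℕ) : Prop :=
  ∃ (kε : ℕ) (J : ℕ → ℕ),
    IsLeast {k | P.IsEpsStationary t ε (z k)} kε ∧
    (∀ k < kε, P.StopsAfter t it (z k) (la k) (lc k) (J k) ∧
      ∃ s, P.Accepts t it (z k) (P.primal t (z k) (erg (lc k) (J k))) s) ∧
    ∑ k ∈ Finset.range kε, J k = N

/-- `c₃ = min {1, c₁ / (2 c₂)}` with `c₁ = 1 + 1 / (√(1+ρ) + √ρ)²`, `c₂ = t/τ + 2 t G_F M₂`,
`τ = (max {M₁², 1} L)⁻¹`, `L = L_f + L_h L_c`; this is `c_l` for `ρ = ρ_l`, and `c_h` for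
`ρ = ρ'`. -/
def decreaseConst (Lf Lh Lc M₁ M₂ t : ℝ) (it : InexactType) : ℝ :=
  let τ := (max (M₁ ^ 2) 1 * (Lf + Lh * Lc))⁻¹
  let c₂ := t / τ + 2 * t * P.GF Lh * M₂
  min 1 (it.c₀ / (2 * c₂))

/-- `j_{ε,l}` and `j_{ε,h}`. -/
def jEps (C : ℝ) (it : InexactType) (ε : ℝ) : ℝ :=
  match it with
  | .lacc ρ => max 1 (1 / ε * √(2 * C * (1 + ρ) * P.supGradC ^ 2 * P.conjDiam ^ 2 / ρ))
  | .hacc ρ => max 1 (1 / ε * √(2 * C * (1 + √ρ) ^ 2 * P.supGradC ^ 2 * P.conjDiam ^ 2 / ρ))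

end CompositeProblem

end IManPL

end

noncomputable section

namespace IManPL

/-! ### The sequence `γ_j` -/

/-! The proof multiplies a bound on the outer iterations by a bound on the dual solver at each
non-stationary point. Inner bound: the dual smooth part is quadratic, and its linearization at `v`
is minus the Lagrangian of the subproblem at the primal point `x(v)` (`dualSmooth_linearization`).
Accelerated gradient theory bounds the dual value by a weighted sum of such linearizations
(`apg_estimate`). Jensen moves the sum to the ergodic average, and Fenchel–Moreau turns the supremum
over multipliers into the primal value. Hence the duality gap after `j + 1` steps is at most `2 t ‖B
P Bᵀ‖ D² / (j + 2)²` (`IsAPG.gap_le`). At a point that is not `ε`-stationary the exact step is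
longer than `t ε`, so a gap of order `t ε²` forces the stopping test, which takes at most `⌊j_ε⌋`
steps. Outer bound: strong convexity of the proximal model makes the model decrease `H = F(z) -
F_t(z̃; z)` at least `t ε² / (2 (1 + ρ))` once the test holds; (HACC) reduces to (LACC) with `ρ'`.
The retraction perturbs the model only to second order, so backtracking terminates and keeps the
fraction `ĉ / 2` of `H` (`decrease_of_accepts`). Telescoping `F` against `F_⋆` counts the outer
iterations. -/

theorem gam_pos : ∀ j, 0 < gam j
  | 0 => by simp [gam]
  | j + 1 => by rw [gam]; positivity

theorem inv_gam_succ (j : ℕ) : (gam (j + 1))⁻¹ = (1 + √(1 + 4 / gam j ^ 2)) / 2 := by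
  rw [gam, inv_div]

/-- The recursion for `gam` is the positive root of this quadratic. Equivalently `(1 - γ_{j+1}) /
γ_{j+1}² = 1 / γ_j²`, which makes the accelerated estimates telescope. -/
theorem inv_gam_succ_sq (j : ℕ) :
    (gam (j + 1))⁻¹ ^ 2 - (gam (j + 1))⁻¹ = (gam j)⁻¹ ^ 2 := by
  have h := Real.sq_sqrt (show 0 ≤ 1 + 4 / gam j ^ 2 by positivity)
  rw [inv_gam_succ, inv_pow, inv_eq_one_div]
  linear_combination h / 4

theorem half_add_inv_gam_le (j : ℕ) : 1 / 2 + (gam j)⁻¹ ≤ (gam (j + 1))⁻¹ := by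
  have hp := inv_pos.2 (gam_pos j)
  have h : 2 * (gam j)⁻¹ ≤ √(1 + 4 / gam j ^ 2) := by
    apply Real.le_sqrt_of_sq_le
    rw [mul_pow, inv_pow, div_eq_mul_inv]
    linarith
  rw [inv_gam_succ]
  linarith

theorem le_inv_gam (j : ℕ) : ((j : ℝ) + 2) / 2 ≤ (gam j)⁻¹ := by
  induction j with
  | zero => simp [gam]
  | succ j ih =>
    have := half_add_inv_gam_le j
    push_cast
    linarith

theorem gam_le_one (j : ℕ) : gam j ≤ 1 := by
  have h := le_inv_gam j
  have : 1 ≤ (gam j)⁻¹ := by linarith [(Nat.cast_nonneg j : (0 : ℝ) ≤ j)]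
  exact (one_le_inv₀ (gam_pos j)).1 this

theorem sum_inv_gam (j : ℕ) : ∑ i ∈ Finset.range (j + 1), (gam i)⁻¹ = (gam j)⁻¹ ^ 2 := by
  induction j with
  | zero => simp [gam]
  | succ j ih => rw [Finset.sum_range_succ, ih]; linarith [inv_gam_succ_sq j]

/-! ### Proximal steps and the accelerated proximal gradient method -/

section Prox

variable {V : Type*} [NormedAddCommGroup V] [InnerProductSpace ℝ V]

theorem norm_lineMap_sub_sq (s : ℝ) (x y b : V) :
    ‖(1 - s) • x + s • y - b‖ ^ 2
      = (1 - s) * ‖x - b‖ ^ 2 + s * ‖y - b‖ ^ 2 - s * (1 - s) * ‖y - x‖ ^ 2 := by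
  have e : (1 - s) • x + s • y - b = (x - b) + s • (y - x) := by module
  have e2 : y - b = (x - b) + (y - x) := by abel
  rw [e, e2, norm_add_sq_real, norm_add_sq_real, norm_smul, inner_smul_right, mul_pow,
    Real.norm_eq_abs, sq_abs]
  ring

/-- The three-point inequality for the minimizer of a convex function plus a squared norm. -/
theorem prox_three_point {S : Set V} {g : V → ℝ} (hg : ConvexOn ℝ S g) {κ : ℝ}
    {b x y : V} (hx : x ∈ S) (hy : y ∈ S)
    (hmin : ∀ u ∈ S, κ / 2 * ‖x - b‖ ^ 2 + g x ≤ κ / 2 * ‖u - b‖ ^ 2 + g u) :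
    κ / 2 * ‖x - b‖ ^ 2 + g x + κ / 2 * ‖y - x‖ ^ 2 ≤ κ / 2 * ‖y - b‖ ^ 2 + g y := by
  -- The minimizer is compared with a point at fraction `s` of the segment towards `y`; dividing by
  -- `s` and letting `s → 0` recovers the full quadratic term.
  have key : ∀ s ∈ Set.Ioo (0 : ℝ) 1,
      κ / 2 * ‖x - b‖ ^ 2 + g x + (1 - s) * (κ / 2 * ‖y - x‖ ^ 2)
        ≤ κ / 2 * ‖y - b‖ ^ 2 + g y := by
    rintro s ⟨hs0, hs1⟩
    have h1 := hmin _ (hg.1 hx hy (by linarith : 0 ≤ 1 - s) hs0.le (by ring))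
    have h2 := hg.2 hx hy (by linarith : 0 ≤ 1 - s) hs0.le (by ring)
    rw [norm_lineMap_sub_sq] at h1
    simp only [smul_eq_mul] at h2
    refine le_of_mul_le_mul_left ?_ hs0
    linarith
  have hlim : Filter.Tendsto
      (fun s : ℝ => κ / 2 * ‖x - b‖ ^ 2 + g x + (1 - s) * (κ / 2 * ‖y - x‖ ^ 2))
      (nhdsWithin 0 (Set.Ioi 0))
      (nhds (κ / 2 * ‖x - b‖ ^ 2 + g x + (1 - 0) * (κ / 2 * ‖y - x‖ ^ 2))) :=
    (Continuous.tendsto (by fun_prop) 0).mono_left nhdsWithin_le_nhds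
  rw [sub_zero, one_mul] at hlim
  refine le_of_tendsto hlim ?_
  filter_upwards [Ioo_mem_nhdsGT (zero_lt_one' ℝ)] with s hs using key s hs

/-- The estimate behind the accelerated proximal gradient method with step sizes `gam`, for the
minimization of `φ + g` over `S`. -/
theorem apg_estimate {S : Set V} {g φ : V → ℝ} {φ' : V → V} {L : ℝ} (hg : ConvexOn ℝ S g)
    (hφ₁ : ∀ u v, φ v + ⟪u - v, φ' v⟫ ≤ φ u)
    (hφ₂ : ∀ u v, φ u ≤ φ v + ⟪u - v, φ' v⟫ + L / 2 * ‖u - v‖ ^ 2)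
    {la lb lc : ℕ → V}
    (hlc : ∀ j, lc (j + 1) = (1 - gam j) • la j + gam j • lb j)
    (hla : ∀ j, la (j + 1) = (1 - gam j) • la j + gam j • lb (j + 1))
    (hlaS : ∀ j, la j ∈ S) (hlbS : ∀ j, lb (j + 1) ∈ S)
    (hlb : ∀ j, ∀ l ∈ S,
      gam j * L / 2 * ‖lb (j + 1) - lb j‖ ^ 2 + (⟪lb (j + 1) - lc (j + 1), φ' (lc (j + 1))⟫
          + g (lb (j + 1)))
        ≤ gam j * L / 2 * ‖l - lb j‖ ^ 2 + (⟪l - lc (j + 1), φ' (lc (j + 1))⟫ + g l))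
    {l : V} (hl : l ∈ S) (j : ℕ) :
    (gam j)⁻¹ ^ 2 * (φ (la (j + 1)) + g (la (j + 1))) + L / 2 * ‖l - lb (j + 1)‖ ^ 2
      ≤ ∑ i ∈ Finset.range (j + 1),
          (gam i)⁻¹ * (φ (lc (i + 1)) + ⟪l - lc (i + 1), φ' (lc (i + 1))⟫ + g l)
        + L / 2 * ‖l - lb 0‖ ^ 2 := by
  have step : ∀ j, φ (la (j + 1)) + g (la (j + 1)) ≤ (1 - gam j) * (φ (la j) + g (la j))
      + gam j * (φ (lc (j + 1)) + ⟪l - lc (j + 1), φ' (lc (j + 1))⟫ + g l)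
      + gam j ^ 2 * (L / 2 * ‖l - lb j‖ ^ 2 - L / 2 * ‖l - lb (j + 1)‖ ^ 2) := by
    intro j
    have h0 := (gam_pos j).le
    have h1 := gam_le_one j
    have hconv : ConvexOn ℝ S (fun u => ⟪u - lc (j + 1), φ' (lc (j + 1))⟫ + g u) := by
      refine ConvexOn.add ⟨hg.1, fun u _ v _ a b _ _ hab => le_of_eq ?_⟩ hg
      have : a • u + b • v - lc (j + 1) = a • (u - lc (j + 1)) + b • (v - lc (j + 1)) := by
        rw [smul_sub, smul_sub]
        nth_rewrite 1 [← one_smul ℝ (lc (j + 1)), ← hab]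
        module
      simp only [this, inner_add_left, real_inner_smul_left, smul_eq_mul]
    have hp := prox_three_point hconv (hlbS j) hl (hlb j)
    have hd := hφ₂ (la (j + 1)) (lc (j + 1))
    have hga := hg.2 (hlaS j) (hlbS j) (by linarith : 0 ≤ 1 - gam j) h0 (by ring)
    rw [← hla] at hga
    -- This identity makes the smoothness error `γ² L / 2 ‖lb (j + 1) - lb j‖²`, exactly what `γ`
    -- times the proximal inequality `hp` absorbs.
    have e1 : la (j + 1) - lc (j + 1) = gam j • (lb (j + 1) - lb j) := by
      rw [hla, hlc]; module
    have e2 : ⟪la (j + 1) - lc (j + 1), φ' (lc (j + 1))⟫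
        = (1 - gam j) * ⟪la j - lc (j + 1), φ' (lc (j + 1))⟫
          + gam j * ⟪lb (j + 1) - lc (j + 1), φ' (lc (j + 1))⟫ := by
      rw [← real_inner_smul_left, ← real_inner_smul_left, ← inner_add_left, hla]
      congr 1; module
    rw [e2, e1, norm_smul, mul_pow, Real.norm_eq_abs, sq_abs] at hd
    have h3 := mul_le_mul_of_nonneg_left (hφ₁ (la j) (lc (j + 1)))
      (by linarith : 0 ≤ 1 - gam j)
    have h4 := mul_le_mul_of_nonneg_left hp h0
    simp only [smul_eq_mul] at hga
    linarith
  induction j with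
  | zero =>
    -- Since `gam 0 = 1`, the value at `la 0` drops out.
    have := step 0
    simp only [gam, sub_self, zero_mul, zero_add, one_mul, one_pow] at this
    simp only [gam, zero_add, Finset.sum_range_one, inv_one, one_mul, one_pow]
    linarith
  | succ j ih =>
    have h := step (j + 1)
    have hp := gam_pos (j + 1)
    have hs := inv_gam_succ_sq j
    rw [Finset.sum_range_succ]
    set θ := (gam (j + 1))⁻¹ with hθ
    have hgθ : gam (j + 1) * θ = 1 := mul_inv_cancel₀ hp.ne'
    have h' := mul_le_mul_of_nonneg_left h (by positivity : 0 ≤ θ ^ 2)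
    have e1 : θ ^ 2 * (1 - gam (j + 1)) = (gam j)⁻¹ ^ 2 := by
      rw [← hs]; linear_combination (-θ) * hgθ
    have e2 : θ ^ 2 * gam (j + 1) = θ := by linear_combination θ * hgθ
    have e3 : θ ^ 2 * gam (j + 1) ^ 2 = 1 := by
      rw [← mul_pow, mul_comm, hgθ, one_pow]
    rw [mul_add (θ ^ 2) (_ + _), mul_add (θ ^ 2) ((1 - gam (j + 1)) * _), ← mul_assoc, ← mul_assoc,
      ← mul_assoc, e1, e2, e3] at h'
    linarith

end Prox

/-! ### Quadratic bound for functions with Lipschitz derivative -/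

theorem norm_sub_sub_fderiv_le {V W : Type*} [NormedAddCommGroup V] [NormedSpace ℝ V]
    [NormedAddCommGroup W] [NormedSpace ℝ W] {f : V → W} (hf : Differentiable ℝ f) {L : ℝ}
    (hL : ∀ x y, ‖fderiv ℝ f x - fderiv ℝ f y‖ ≤ L * ‖x - y‖) (x y : V) :
    ‖f y - f x - fderiv ℝ f x (y - x)‖ ≤ L / 2 * ‖y - x‖ ^ 2 := by
  set v := y - x
  let G : ℝ → W := fun s => f (x + s • v) - f x - s • fderiv ℝ f x v
  have hG : ∀ s, HasDerivAt G (fderiv ℝ f (x + s • v) v - fderiv ℝ f x v) s := by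
    intro s
    have h1 : HasDerivAt (fun s : ℝ => x + s • v) v s := by
      simpa using ((hasDerivAt_id s).smul_const v).const_add x
    have h2 := (hf (x + s • v)).hasFDerivAt.comp_hasDerivAt s h1
    have h3 : HasDerivAt (fun s : ℝ => s • fderiv ℝ f x v) (fderiv ℝ f x v) s := by
      simpa using (hasDerivAt_id s).smul_const (fderiv ℝ f x v)
    exact (h2.sub_const (f x)).sub h3
  have hB : ∀ s : ℝ, HasDerivAt (fun s : ℝ => L / 2 * ‖v‖ ^ 2 * s ^ 2) (L * ‖v‖ ^ 2 * s) s := by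
    intro s
    convert! (hasDerivAt_pow 2 s).const_mul (L / 2 * ‖v‖ ^ 2) using 1
    norm_num
    ring
  -- `G` is the Taylor remainder along the segment. Its norm is compared with `L / 2 ‖v‖² s²`
  -- through the derivatives, so no integral is needed.
  have h := image_norm_le_of_norm_deriv_right_le_deriv_boundary (f := G) (a := 0) (b := 1)
    (fun s _ => (hG s).continuousAt.continuousWithinAt)
    (fun s _ => (hG s).hasDerivWithinAt) (B := fun s => L / 2 * ‖v‖ ^ 2 * s ^ 2)
    (by simp [G]) hB ?_ (Set.right_mem_Icc.2 zero_le_one)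
  · simpa [G, v] using h
  · rintro s ⟨hs, -⟩
    rw [← sub_apply]
    refine (ContinuousLinearMap.le_opNorm _ _).trans ?_
    have := hL (x + s • v) x
    rw [add_sub_cancel_left, norm_smul, Real.norm_of_nonneg hs] at this
    calc _ ≤ L * (s * ‖v‖) * ‖v‖ := by gcongr
      _ = _ := by ring

namespace CompositeProblem

variable {n m d : ℕ} (P : CompositeProblem n m d)

/-! ### The convex conjugate -/

/-- The value of the conjugate as a real number, meaningful on its effective domain. -/
def conjVal (l : E m) : ℝ := (P.conj l).toReal

theorem conj_ne_bot (l : E m) : P.conj l ≠ ⊥ := by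
  have h : ((⟪(0 : E m), l⟫ - P.h 0 : ℝ) : EReal) ≤ P.conj l :=
    le_iSup (fun y : E m => ((⟪y, l⟫ - P.h y : ℝ) : EReal)) 0
  intro hb
  rw [hb, le_bot_iff] at h
  exact EReal.coe_ne_bot _ h

theorem coe_conjVal {l : E m} (hl : P.conj l < ⊤) : (P.conjVal l : EReal) = P.conj l :=
  EReal.coe_toReal hl.ne (P.conj_ne_bot l)

theorem inner_sub_le_conjVal {l : E m} (hl : P.conj l < ⊤) (y : E m) :
    ⟪y, l⟫ - P.h y ≤ P.conjVal l := by
  have h : ((⟪y, l⟫ - P.h y : ℝ) : EReal) ≤ P.conj l :=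
    le_iSup (fun y : E m => ((⟪y, l⟫ - P.h y : ℝ) : EReal)) y
  rw [← P.coe_conjVal hl] at h
  exact EReal.coe_le_coe_iff.1 h

theorem conj_le_coe {l : E m} {a : ℝ} (h : ∀ y, ⟪y, l⟫ - P.h y ≤ a) : P.conj l ≤ a :=
  iSup_le fun y => EReal.coe_le_coe_iff.2 (h y)

theorem conj_lt_top {l : E m} {a : ℝ} (h : ∀ y, ⟪y, l⟫ - P.h y ≤ a) : P.conj l < ⊤ :=
  (P.conj_le_coe h).trans_lt (EReal.coe_lt_top a)

theorem conjVal_le {l : E m} {a : ℝ} (h : ∀ y, ⟪y, l⟫ - P.h y ≤ a) : P.conjVal l ≤ a := by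
  have h' := P.conj_le_coe h
  rw [← P.coe_conjVal (P.conj_lt_top h)] at h'
  exact EReal.coe_le_coe_iff.1 h'

theorem convexOn_conjVal : ConvexOn ℝ {l | P.conj l < ⊤} P.conjVal := by
  have key : ∀ x ∈ {l | P.conj l < ⊤}, ∀ y ∈ {l | P.conj l < ⊤}, ∀ a b : ℝ, 0 ≤ a → 0 ≤ b →
      a + b = 1 → ∀ u, ⟪u, a • x + b • y⟫ - P.h u ≤ a * P.conjVal x + b * P.conjVal y := by
    intro x hx y hy a b ha hb hab u
    have h1 := mul_le_mul_of_nonneg_left (P.inner_sub_le_conjVal hx u) ha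
    have h2 := mul_le_mul_of_nonneg_left (P.inner_sub_le_conjVal hy u) hb
    rw [inner_add_right, inner_smul_right, inner_smul_right]
    have : P.h u = a * P.h u + b * P.h u := by rw [← add_mul, hab, one_mul]
    linarith
  exact ⟨fun x hx y hy a b ha hb hab => P.conj_lt_top (key x hx y hy a b ha hb hab),
    fun x hx y hy a b ha hb hab => P.conjVal_le (key x hx y hy a b ha hb hab)⟩

variable {P} {Lf Lh Lc M₁ M₂ : ℝ}

/-- Along the ray `s • l`, the pairing grows like `s ‖l‖²` but `h` at most like `s Lh ‖l‖`, so a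
longer `l` has infinite conjugate. Boundedness of the domain is what makes `Metric.diam` a genuine
diameter and not its default value `0`. -/
theorem Assumption.norm_le_of_conj_lt_top (hP : P.Assumption Lf Lh Lc M₁ M₂) {l : E m}
    (hl : P.conj l < ⊤) : ‖l‖ ≤ Lh := by
  by_contra! hlt
  have hl0 : 0 < ‖l‖ := hP.Lh_pos.trans hlt
  have hpos : 0 < ‖l‖ * (‖l‖ - Lh) := mul_pos hl0 (by linarith)
  obtain ⟨s, hs⟩ := exists_nat_gt ((P.conjVal l + P.h 0) / (‖l‖ * (‖l‖ - Lh)))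
  rw [div_lt_iff₀ hpos] at hs
  have h1 := P.inner_sub_le_conjVal hl ((s : ℝ) • l)
  have h2 := (le_abs_self _).trans (hP.h_lip ((s : ℝ) • l) 0)
  rw [real_inner_smul_left, real_inner_self_eq_norm_sq] at h1
  rw [sub_zero, norm_smul, Real.norm_of_nonneg s.cast_nonneg] at h2
  linarith

theorem Assumption.norm_sub_le_conjDiam (hP : P.Assumption Lf Lh Lc M₁ M₂) {l l' : E m}
    (hl : P.conj l < ⊤) (hl' : P.conj l' < ⊤) : ‖l - l'‖ ≤ P.conjDiam := by
  rw [← dist_eq_norm]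
  refine Metric.dist_le_diam_of_mem ?_ hl hl'
  exact isBounded_iff_forall_norm_le.2 ⟨Lh, fun l hl => hP.norm_le_of_conj_lt_top hl⟩

theorem Assumption.continuous_h (hP : P.Assumption Lf Lh Lc M₁ M₂) : Continuous P.h := by
  refine (LipschitzWith.of_dist_le_mul (K := Lh.toNNReal) fun x y => ?_).continuous
  rw [Real.dist_eq, dist_eq_norm, Real.coe_toNNReal _ hP.Lh_pos.le]
  exact hP.h_lip x y

/-- The nontrivial half of Fenchel–Moreau: a continuous convex function has affine minorants
arbitrarily close to it at any given point, and their slopes lie in the domain of the conjugate. -/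
theorem Assumption.exists_conj_near (hP : P.Assumption Lf Lh Lc M₁ M₂) (y : E m) {a : ℝ}
    (ha : a < P.h y) : ∃ l, P.conj l < ⊤ ∧ a ≤ ⟪y, l⟫ - P.conjVal l := by
  obtain ⟨φ, b, hφ, hφa⟩ := ConvexOn.exists_affine_le_of_lt (𝕜 := ℝ) (Set.mem_univ y) ha
    isClosed_univ (hP.continuous_h.lowerSemicontinuous.lowerSemicontinuousOn _) hP.h_convex
  set l := (InnerProductSpace.toDual ℝ (E m)).symm φ
  have hl : ∀ u, ⟪u, l⟫ = φ u := fun u => by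
    rw [real_inner_comm, InnerProductSpace.toDual_symm_apply]
  have hle : ∀ u, ⟪u, l⟫ - P.h u ≤ -b := fun u => by
    have h : φ u + b ≤ P.h u := hφ ⟨u, Set.mem_univ u⟩
    rw [hl]
    linarith
  refine ⟨l, P.conj_lt_top hle, ?_⟩
  have h := P.conjVal_le hle
  have h' : φ y + b = a := hφa
  rw [hl]
  linarith

/-! ### The dual problem -/

variable (P) (t : ℝ) (z : P.M)

/-- The orthogonal projection of `Bᵀλ + ∇f(z)` onto the tangent space at `z`. -/
def dualProj (l : E m) : E n :=
  (P.T z).starProjection (ContinuousLinearMap.adjoint (P.B z) l + gradient P.f z)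

/-- The transpose `(I - CᵀC) Bᵀ` of `B` restricted to the tangent space. -/
def projAdjoint : E m →L[ℝ] E n :=
  (P.T z).starProjection ∘L ContinuousLinearMap.adjoint (P.B z)

/-- The smooth part of `-D`. -/
def dualSmooth (l : E m) : ℝ := t / 2 * ‖P.dualProj z l‖ ^ 2 - ⟪l, P.c z⟫ - P.f z

/-- The dual function as a real number, meaningful on the effective domain of the conjugate. -/
def dualVal (l : E m) : ℝ := -(P.dualSmooth t z l + P.conjVal l)

theorem coe_primal (l : E m) : (P.primal t z l : E n) = -(t • P.dualProj z l) := rfl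

theorem dualGrad_eq (l : E m) : P.dualGrad t z l = t • P.B z (P.dualProj z l) - P.c z := rfl

theorem inner_dualProj {v : E n} (hv : v ∈ P.T z) (l : E m) :
    ⟪P.dualProj z l, v⟫ = ⟪l, P.B z v⟫ + ⟪gradient P.f z, v⟫ := by
  rw [dualProj, Submodule.inner_starProjection_left_eq_right,
    Submodule.starProjection_eq_self_iff.2 hv, inner_add_left,
    ContinuousLinearMap.adjoint_inner_left]

theorem dualProj_mem (l : E m) : P.dualProj z l ∈ P.T z := Submodule.starProjection_apply_mem _ _

theorem projAdjoint_mem (l : E m) : P.projAdjoint z l ∈ P.T z :=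
  Submodule.starProjection_apply_mem _ _

theorem inner_projAdjoint {v : E n} (hv : v ∈ P.T z) (l : E m) :
    ⟪P.projAdjoint z l, v⟫ = ⟪l, P.B z v⟫ := by
  rw [projAdjoint, ContinuousLinearMap.comp_apply, Submodule.inner_starProjection_left_eq_right,
    Submodule.starProjection_eq_self_iff.2 hv, ContinuousLinearMap.adjoint_inner_left]

theorem dualProj_eq_add (u v : E m) :
    P.dualProj z u = P.dualProj z v + P.projAdjoint z (u - v) := by
  simp only [dualProj, projAdjoint, ContinuousLinearMap.comp_apply, map_add, map_sub]
  abel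

theorem norm_projAdjoint_sq_le (l : E m) :
    ‖P.projAdjoint z l‖ ^ 2 ≤ ‖P.dualHess z‖ * ‖l‖ ^ 2 := by
  have h : ‖P.projAdjoint z l‖ ^ 2 = ⟪l, P.dualHess z l⟫ := by
    rw [← real_inner_self_eq_norm_sq, P.inner_projAdjoint z (P.projAdjoint_mem z l)]
    rfl
  rw [h]
  refine (real_inner_le_norm _ _).trans ?_
  calc ‖l‖ * ‖P.dualHess z l‖ ≤ ‖l‖ * (‖P.dualHess z‖ * ‖l‖) := by
        gcongr; exact ContinuousLinearMap.le_opNorm _ _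
    _ = _ := by ring

theorem norm_dualHess_le : ‖P.dualHess z‖ ≤ ‖P.B z‖ ^ 2 := by
  refine (ContinuousLinearMap.opNorm_comp_le _ _).trans ?_
  have h : ‖(P.T z).starProjection ∘L ContinuousLinearMap.adjoint (P.B z)‖ ≤ 1 * ‖P.B z‖ := by
    refine (ContinuousLinearMap.opNorm_comp_le _ _).trans ?_
    rw [LinearIsometryEquiv.norm_map]
    gcongr
    exact Submodule.starProjection_norm_le _
  rw [one_mul] at h
  rw [pow_two]
  gcongr

theorem dualSmooth_eq (u v : E m) :
    P.dualSmooth t z u = P.dualSmooth t z v + ⟪u - v, P.dualGrad t z v⟫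
      + t / 2 * ‖P.projAdjoint z (u - v)‖ ^ 2 := by
  rw [dualSmooth, dualSmooth, P.dualProj_eq_add z u v, dualGrad_eq, norm_add_sq_real,
    inner_sub_right, inner_smul_right, ← P.inner_projAdjoint z (P.dualProj_mem z v),
    real_inner_comm (P.dualProj z v), inner_sub_left u v (P.c z)]
  ring

variable {t}

/-- The primal-dual link: the right side is minus the Lagrangian at the primal point of `v` with
multiplier `l`. Subtracting `h_⋆(l)` from the Lagrangian and taking the supremum over `l` recovers
`Fprox` at that point. -/
theorem dualSmooth_linearization (ht : 0 < t) (l v : E m) :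
    P.dualSmooth t z v + ⟪l - v, P.dualGrad t z v⟫
      = -(P.f z + ⟪gradient P.f z, (P.primal t z v : E n)⟫
          + ⟪l, P.c z + P.B z (P.primal t z v)⟫ + 1 / (2 * t) * ‖(P.primal t z v : E n)‖ ^ 2) := by
  have h1 := P.inner_dualProj z (P.dualProj_mem z v) v
  rw [real_inner_self_eq_norm_sq] at h1
  rw [coe_primal, dualGrad_eq, dualSmooth, norm_neg, norm_smul, mul_pow, Real.norm_eq_abs, sq_abs,
    map_neg, map_smul, inner_neg_right, inner_add_right, inner_neg_right, inner_smul_right,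
    inner_smul_right, inner_sub_right, inner_smul_right, inner_sub_left, inner_sub_left]
  have e : 1 / (2 * t) * (t ^ 2 * ‖P.dualProj z v‖ ^ 2) = t / 2 * ‖P.dualProj z v‖ ^ 2 := by
    field_simp
  rw [e]
  linear_combination t * h1

theorem Fprox_add (v : E n) : P.Fprox t (v + z) z
    = P.f z + ⟪gradient P.f z, v⟫ + P.h (P.c z + P.B z v) + 1 / (2 * t) * ‖v‖ ^ 2 := by
  rw [Fprox, Flin, add_sub_cancel_right, B]

/-- Weak duality: the Fenchel–Young inequality plus a completed square in `v`. -/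
theorem dualVal_le_Fprox (ht : 0 < t) {l : E m} (hl : P.conj l < ⊤) {v : E n} (hv : v ∈ P.T z) :
    P.dualVal t z l ≤ P.Fprox t (v + z) z := by
  rw [Fprox_add, dualVal, dualSmooth]
  have h1 := P.inner_sub_le_conjVal hl (P.c z + P.B z v)
  have h2 := P.inner_dualProj z hv l
  rw [inner_add_left, real_inner_comm l, real_inner_comm l] at h1
  have h3 : 0 ≤ t / 2 * ‖P.dualProj z l + (1 / t) • v‖ ^ 2 := by positivity
  rw [norm_add_sq_real, inner_smul_right, norm_smul, mul_pow, Real.norm_eq_abs, sq_abs] at h3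
  have e : t / 2 * (‖P.dualProj z l‖ ^ 2 + 2 * (1 / t * ⟪P.dualProj z l, v⟫)
      + (1 / t) ^ 2 * ‖v‖ ^ 2) = t / 2 * ‖P.dualProj z l‖ ^ 2 + ⟪P.dualProj z l, v⟫
        + 1 / (2 * t) * ‖v‖ ^ 2 := by
    field_simp
  rw [e] at h3
  linarith

theorem dual_eq_coe {l : E m} (hl : P.conj l < ⊤) : P.dual t z l = (P.dualVal t z l : EReal) := by
  have h : ‖P.dualProj z l‖ ^ 2 = ⟪ContinuousLinearMap.adjoint (P.B z) l + gradient P.f z,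
      P.dualProj z l⟫ := by
    rw [← real_inner_self_eq_norm_sq]
    nth_rewrite 1 [dualProj]
    rw [Submodule.inner_starProjection_left_eq_right,
      Submodule.starProjection_eq_self_iff.2 (P.dualProj_mem z l)]
  rw [dual, ← P.coe_conjVal hl, ← EReal.coe_sub, dualVal, dualSmooth, h, dualProj]
  congr 1
  ring

/-! ### The accelerated proximal gradient method for the dual problem -/

variable {P z}

namespace IsAPG

variable {la lb lc : ℕ → E m}

theorem conj_lb_lt_top (h : P.IsAPG t z la lb lc) (j : ℕ) : P.conj (lb (j + 1)) < ⊤ := by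
  have hm := h.step_b j (Set.mem_univ (la 0))
  rw [lt_top_iff_ne_top]
  intro htop
  simp only [Set.mem_ofPred_eq, htop, EReal.coe_add_top, top_le_iff] at hm
  rw [← P.coe_conjVal h.init_dom, ← EReal.coe_add] at hm
  exact EReal.coe_ne_top _ hm

theorem conj_la_lt_top (h : P.IsAPG t z la lb lc) (j : ℕ) : P.conj (la j) < ⊤ := by
  induction j with
  | zero => exact h.init_dom
  | succ j ih =>
    rw [h.step_a]
    exact P.convexOn_conjVal.1 ih (h.conj_lb_lt_top j) (by linarith [gam_le_one j])
      (gam_pos j).le (by ring)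

theorem lb_min (h : P.IsAPG t z la lb lc) (j : ℕ) {l : E m} (hl : P.conj l < ⊤) :
    gam j * (t * ‖P.dualHess z‖) / 2 * ‖lb (j + 1) - lb j‖ ^ 2
        + (⟪lb (j + 1) - lc (j + 1), P.dualGrad t z (lc (j + 1))⟫ + P.conjVal (lb (j + 1)))
      ≤ gam j * (t * ‖P.dualHess z‖) / 2 * ‖l - lb j‖ ^ 2
        + (⟪l - lc (j + 1), P.dualGrad t z (lc (j + 1))⟫ + P.conjVal l) := by
  have hm := h.step_b j (Set.mem_univ l)
  simp only [Set.mem_ofPred_eq] at hm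
  rw [← P.coe_conjVal hl, ← P.coe_conjVal (h.conj_lb_lt_top j), ← EReal.coe_add, ← EReal.coe_add,
    EReal.coe_le_coe_iff] at hm
  -- With `x / 0 = 0` this also holds when `dualHess` vanishes, so no case split is needed.
  have e : gam j / (2 * P.step t z) = gam j * (t * ‖P.dualHess z‖) / 2 := by
    rw [step, div_mul_eq_div_div, div_inv_eq_mul]; ring
  rw [e] at hm
  linarith

/-- By `dualSmooth_eq` the linearization at `μ`, evaluated at a fixed `l`, is a constant minus a
convex quadratic in `μ`. Jensen therefore replaces all base points by their weighted average, the
ergodic point. -/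
theorem sum_linearization_le (ht : 0 ≤ t) (lc : ℕ → E m) (l : E m) (j : ℕ) :
    ∑ i ∈ Finset.range (j + 1), (gam i)⁻¹ * (P.dualSmooth t z (lc (i + 1))
        + ⟪l - lc (i + 1), P.dualGrad t z (lc (i + 1))⟫ + P.conjVal l)
      ≤ (gam j)⁻¹ ^ 2 * (P.dualSmooth t z (erg lc (j + 1))
        + ⟪l - erg lc (j + 1), P.dualGrad t z (erg lc (j + 1))⟫ + P.conjVal l) := by
  have hconv : ConvexOn ℝ Set.univ fun μ : E m => ‖P.projAdjoint z (l - μ)‖ ^ 2 := by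
    refine ⟨convex_univ, fun x _ y _ a b ha hb hab => ?_⟩
    obtain rfl : a = 1 - b := by linarith
    have e : P.projAdjoint z (l - ((1 - b) • x + b • y))
        = (1 - b) • P.projAdjoint z (l - x) + b • P.projAdjoint z (l - y) - 0 := by
      rw [← map_smul, ← map_smul, ← map_add, sub_zero]
      congr 1; module
    simp only [e]
    rw [norm_lineMap_sub_sq, sub_zero, sub_zero, smul_eq_mul, smul_eq_mul]
    have : 0 ≤ b * (1 - b) * ‖P.projAdjoint z (l - y) - P.projAdjoint z (l - x)‖ ^ 2 := by
      positivity
    linarith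
  have hsum := sum_inv_gam j
  have hΘ : 0 < (gam j)⁻¹ ^ 2 := by have := gam_pos j; positivity
  have hJ := hconv.map_centerMass_le (t := Finset.range (j + 1)) (w := fun i => (gam i)⁻¹)
    (p := fun i => lc (i + 1)) (fun i _ => (inv_pos.2 (gam_pos i)).le) (hsum ▸ hΘ)
    (fun _ _ => Set.mem_univ _)
  have hc : (Finset.range (j + 1)).centerMass (fun i => (gam i)⁻¹) (fun i => lc (i + 1))
      = erg lc (j + 1) := rfl
  rw [hc, Finset.centerMass, hsum, smul_eq_mul, ← div_eq_inv_mul, le_div_iff₀' hΘ] at hJ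
  have e : ∀ μ, P.dualSmooth t z μ + ⟪l - μ, P.dualGrad t z μ⟫ + P.conjVal l
      = P.dualSmooth t z l + P.conjVal l - t / 2 * ‖P.projAdjoint z (l - μ)‖ ^ 2 := fun μ => by
    rw [P.dualSmooth_eq t z l μ]; ring
  simp only [e, mul_sub, Finset.sum_sub_distrib, ← Finset.sum_mul, hsum]
  have h2 := mul_le_mul_of_nonneg_left hJ (by positivity : 0 ≤ t / 2)
  simp only [Function.comp_apply, smul_eq_mul, Finset.mul_sum] at h2
  have e3 : ∀ i, (gam i)⁻¹ * (t / 2 * ‖P.projAdjoint z (l - lc (i + 1))‖ ^ 2)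
      = t / 2 * ((gam i)⁻¹ * ‖P.projAdjoint z (l - lc (i + 1))‖ ^ 2) := fun i => by ring
  simp only [e3]
  linarith

theorem gap_le (h : P.IsAPG t z la lb lc) (hP : P.Assumption Lf Lh Lc M₁ M₂) (ht : 0 < t)
    (j : ℕ) :
    P.Fprox t ((P.primal t z (erg lc (j + 1)) : E n) + z) z - P.dualVal t z (la (j + 1))
      ≤ 2 * (t * ‖P.dualHess z‖ * P.conjDiam ^ 2) / ((j : ℝ) + 2) ^ 2 := by
  set x := (P.primal t z (erg lc (j + 1)) : E n) with hx
  set H := t * ‖P.dualHess z‖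
  have hH : 0 ≤ H := by positivity
  have hj : (0 : ℝ) ≤ j := j.cast_nonneg
  set Θ := (gam j)⁻¹ ^ 2 with hΘdef
  have hΘ : (((j : ℝ) + 2) / 2) ^ 2 ≤ Θ := by
    have := le_inv_gam j
    rw [hΘdef]
    gcongr
  have hΘ0 : 0 < Θ := lt_of_lt_of_le (by positivity) hΘ
  have hbound : ∀ l, P.conj l < ⊤ →
      P.dualSmooth t z (la (j + 1)) + P.conjVal (la (j + 1))
        ≤ P.dualSmooth t z (erg lc (j + 1))
          + ⟪l - erg lc (j + 1), P.dualGrad t z (erg lc (j + 1))⟫ + P.conjVal l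
          + 2 * (H * P.conjDiam ^ 2) / ((j : ℝ) + 2) ^ 2 := by
    intro l hl
    have h1 := apg_estimate P.convexOn_conjVal (φ := P.dualSmooth t z) (φ' := P.dualGrad t z)
      (L := H)
      (fun u v => by
        have : 0 ≤ t / 2 * ‖P.projAdjoint z (u - v)‖ ^ 2 := by positivity
        rw [P.dualSmooth_eq t z u v]; linarith)
      (fun u v => by
        have := mul_le_mul_of_nonneg_left (P.norm_projAdjoint_sq_le z (u - v))
          (by positivity : 0 ≤ t / 2)
        rw [P.dualSmooth_eq t z u v]
        have e : H / 2 * ‖u - v‖ ^ 2 = t / 2 * (‖P.dualHess z‖ * ‖u - v‖ ^ 2) := by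
          simp only [H]; ring
        linarith)
      h.step_c h.step_a h.conj_la_lt_top h.conj_lb_lt_top (fun j l hl => h.lb_min j hl) hl j
    have h2 := sum_linearization_le (P := P) (z := z) ht.le lc l j
    have h3 : ‖l - lb 0‖ ^ 2 ≤ P.conjDiam ^ 2 := by
      have := hP.norm_sub_le_conjDiam hl h.init_dom
      rw [h.init_b]
      gcongr
    have h4 : 0 ≤ H / 2 * ‖l - lb (j + 1)‖ ^ 2 := by positivity
    have h5 := mul_le_mul_of_nonneg_left h3 (by positivity : 0 ≤ H / 2)
    -- The rate comes from the total weight `Θ = γ_j⁻² ≥ ((j + 2) / 2)²`.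
    have h6 : H / 2 * P.conjDiam ^ 2 ≤ Θ * (2 * (H * P.conjDiam ^ 2) / ((j : ℝ) + 2) ^ 2) := by
      refine le_trans (le_of_eq ?_) (mul_le_mul_of_nonneg_right hΘ (by positivity))
      field_simp
    refine le_of_mul_le_mul_left ?_ hΘ0
    rw [mul_add]
    linarith
  rw [Fprox_add, dualVal]
  refine le_of_forall_pos_le_add fun δ hδ => ?_
  -- `hbound` holds for every multiplier; a nearly optimal one for `h` at `c(z) + B x` turns the
  -- Lagrangian into the primal value up to `δ`.
  obtain ⟨l, hl, hl'⟩ := hP.exists_conj_near (P.c z + P.B z x) (sub_lt_self _ hδ)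
  have hb := hbound l hl
  rw [P.dualSmooth_linearization z ht, ← hx, real_inner_comm (P.c z + P.B z x)] at hb
  linarith

end IsAPG

end CompositeProblem

/-! ### Consequences of inexactness -/

section Inexact

variable {V : Type*} [NormedAddCommGroup V] {x s : V} {k G δ : ℝ}

/-- Here `s` is the exact step, `x` the inexact one, `G` the optimal model decrease, `δ` the
suboptimality of `x`, and `k = 1 / (2t)`. With `H = G - δ`, `k ‖s‖² ≤ (1 + ρ) H` and `k ‖x - s‖² ≤ ρ
H`; the triangle inequality gives the factor behind `c₀`. -/
theorem norm_sq_le_of_gap_le {ρ : ℝ} (hk : 0 < k) (hρ : 0 < ρ) (hG : k * ‖s‖ ^ 2 ≤ G)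
    (hδ : k * ‖x - s‖ ^ 2 ≤ δ) (h : δ ≤ ρ * (G - δ)) :
    k * ‖x‖ ^ 2 ≤ (G - δ) * (√(1 + ρ) + √ρ) ^ 2 := by
  have hδ0 : 0 ≤ δ := le_trans (by positivity) hδ
  have hH : 0 ≤ G - δ := by
    by_contra! hneg
    have := mul_neg_of_pos_of_neg hρ hneg
    linarith
  have h1 : √k * ‖s‖ ≤ √(1 + ρ) * √(G - δ) := by
    refine le_of_sq_le_sq ?_ (by positivity)
    rw [mul_pow, mul_pow, Real.sq_sqrt hk.le, Real.sq_sqrt hH, Real.sq_sqrt (by positivity)]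
    linarith
  have h2 : √k * ‖x - s‖ ≤ √ρ * √(G - δ) := by
    refine le_of_sq_le_sq ?_ (by positivity)
    rw [mul_pow, mul_pow, Real.sq_sqrt hk.le, Real.sq_sqrt hH, Real.sq_sqrt hρ.le]
    linarith
  have h3 : √k * ‖x‖ ≤ √(G - δ) * (√(1 + ρ) + √ρ) := by
    have : ‖x‖ ≤ ‖x - s‖ + ‖s‖ := by simpa using norm_add_le (x - s) s
    have := mul_le_mul_of_nonneg_left this (Real.sqrt_nonneg k)
    linarith
  have h4 := pow_le_pow_left₀ (by positivity) h3 2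
  rwa [mul_pow, mul_pow, Real.sq_sqrt hk.le, Real.sq_sqrt hH] at h4

/-- This reduces (HACC) to (LACC) with `ρ'`. With `u = √(δ / k)`, expanding `k (‖x‖ - u)² ≤ G`
produces `δ` itself, so `G - δ` appears with only the cross term to estimate. -/
theorem gap_le_of_gap_le_norm_sq {r : ℝ} (hk : 0 < k) (hr : 0 < r) (hr' : √r < 1 / 2)
    (hG : k * ‖s‖ ^ 2 ≤ G) (hδ : k * ‖x - s‖ ^ 2 ≤ δ) (h : δ ≤ r * (k * ‖x‖ ^ 2)) :
    r * (k * ‖x‖ ^ 2) ≤ r / (1 - 2 * √r) * (G - δ) := by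
  have hδ0 : 0 ≤ δ := le_trans (by positivity) hδ
  set u := √(δ / k)
  have hu : k * u ^ 2 = δ := by
    rw [Real.sq_sqrt (by positivity)]; field_simp
  have h1 : ‖x - s‖ ≤ u := Real.le_sqrt_of_sq_le (by rw [le_div_iff₀ hk]; linarith)
  have h2 : u ≤ √r * ‖x‖ := by
    refine Real.sqrt_le_iff.2 ⟨by positivity, ?_⟩
    rw [mul_pow, Real.sq_sqrt hr.le, div_le_iff₀ hk]
    linarith
  have h3 : ‖x‖ - u ≤ ‖s‖ := by
    have : ‖x‖ ≤ ‖x - s‖ + ‖s‖ := by simpa using norm_add_le (x - s) s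
    linarith
  have h4 : 0 ≤ ‖x‖ - u := by
    have : √r * ‖x‖ ≤ 1 * ‖x‖ := by gcongr; linarith
    linarith
  have h5 : k * (‖x‖ - u) ^ 2 ≤ G :=
    le_trans (by gcongr) hG
  have h6 : k * ‖x‖ * u ≤ k * ‖x‖ * (√r * ‖x‖) := by gcongr
  have h7 : (1 - 2 * √r) * (k * ‖x‖ ^ 2) ≤ G - δ := by
    rw [← hu]
    linarith
  have hpos : 0 < 1 - 2 * √r := by linarith
  rw [div_mul_eq_mul_div, le_div_iff₀ hpos]
  have := mul_le_mul_of_nonneg_left h7 hr.le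
  linarith

/-- The (HACC) test involves the computed step `x`; this replaces it by the exact step, using `‖x‖ ≥
‖s‖ / (1 + √r)`. -/
theorem gap_le_norm_sq_of_gap_le {r : ℝ} (hk : 0 < k) (hr : 0 < r)
    (hδ : k * ‖x - s‖ ^ 2 ≤ δ) (h : δ ≤ r / (1 + √r) ^ 2 * (k * ‖s‖ ^ 2)) :
    δ ≤ r * (k * ‖x‖ ^ 2) := by
  have hpos : 0 < 1 + √r := by positivity
  have h1 : ‖x - s‖ ≤ √r / (1 + √r) * ‖s‖ := by
    refine le_of_sq_le_sq ?_ (by positivity)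
    rw [mul_pow, div_pow, Real.sq_sqrt hr.le]
    refine le_of_mul_le_mul_left ?_ hk
    linarith
  have h2 : ‖s‖ ≤ ‖x - s‖ + ‖x‖ := by
    have := norm_add_le (s - x) x
    rwa [sub_add_cancel, norm_sub_rev] at this
  have h3 : ‖s‖ / (1 + √r) ≤ ‖x‖ := by
    have : √r / (1 + √r) * ‖s‖ + ‖s‖ / (1 + √r) = ‖s‖ := by field_simp; ring
    linarith
  refine h.trans ?_
  have h4 := pow_le_pow_left₀ (by positivity) h3 2
  calc r / (1 + √r) ^ 2 * (k * ‖s‖ ^ 2) = r * (k * (‖s‖ / (1 + √r)) ^ 2) := by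
        rw [div_pow]; ring
    _ ≤ _ := by gcongr

end Inexact

/-! ### Elementary bounds on `ρ` and `c₀` -/

namespace InexactType

variable {it : InexactType}

theorem sqrt_lt_half {ρ : ℝ} (h : ρ < 1 / 4) : √ρ < 1 / 2 := by
  rw [Real.sqrt_lt' (by norm_num)]
  norm_num
  linarith

theorem rho_pos (h : it.Valid) : 0 < it.rho := by
  cases it with
  | lacc ρ => exact h
  | hacc ρ => exact div_pos h.1 (by linarith [sqrt_lt_half h.2])

theorem c₀_pos : 0 < it.c₀ := by rw [c₀]; positivity

theorem c₀_le_two (h : it.Valid) : it.c₀ ≤ 2 := by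
  have hρ := rho_pos h
  have h1 : 1 ≤ √(1 + it.rho) := Real.one_le_sqrt.2 (by linarith)
  have h2 : 1 ≤ (√(1 + it.rho) + √it.rho) ^ 2 :=
    one_le_pow₀ (by linarith [Real.sqrt_nonneg it.rho])
  have h3 : 1 / (√(1 + it.rho) + √it.rho) ^ 2 ≤ 1 := (div_le_one (by positivity)).2 h2
  rw [c₀]
  linarith

/-- Applied with `a = ‖x‖² / (2t)` and `b` the decrease of `F_t`, so that `b + a` is the decrease of
the model without its proximal term. -/
theorem c₀_mul_le (h : it.Valid) {a b : ℝ} (hab : a ≤ b * (√(1 + it.rho) + √it.rho) ^ 2) :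
    it.c₀ * a ≤ b + a := by
  have hρ := rho_pos h
  rw [← div_le_iff₀ (by positivity)] at hab
  rw [c₀, add_mul, one_mul, one_div_mul_eq_div]
  linarith

end InexactType

namespace CompositeProblem

variable {n m d : ℕ} {P : CompositeProblem n m d} {Lf Lh Lc M₁ M₂ t : ℝ} {z : P.M}

/-! ### Bounds over the manifold -/

theorem inner_gradient_eq_fderiv (f : E n → ℝ) (z v : E n) :
    ⟪gradient f z, v⟫ = fderiv ℝ f z v := by
  rw [gradient, InnerProductSpace.toDual_symm_apply]

theorem norm_fderiv_sub_eq (f : E n → ℝ) (z z' : E n) :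
    ‖fderiv ℝ f z - fderiv ℝ f z'‖ = ‖gradient f z - gradient f z'‖ := by
  rw [gradient, gradient, ← map_sub, LinearIsometryEquiv.norm_map]

theorem continuous_of_norm_sub_le {V W : Type*} [SeminormedAddCommGroup V]
    [SeminormedAddCommGroup W] {f : V → W} {L : ℝ} (hL : 0 ≤ L)
    (h : ∀ x y, ‖f x - f y‖ ≤ L * ‖x - y‖) : Continuous f := by
  refine (LipschitzWith.of_dist_le_mul (K := L.toNNReal) fun x y => ?_).continuous
  rw [dist_eq_norm, dist_eq_norm, Real.coe_toNNReal _ hL]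
  exact h x y

theorem Flin_self (y : E n) : P.Flin y y = P.F y := by
  simp [Flin, F]

theorem Fprox_self (y : E n) : P.Fprox t y y = P.F y := by
  simp [Fprox, Flin_self]

namespace Assumption

theorem isCompact_range (hP : P.Assumption Lf Lh Lc M₁ M₂) {g : E n → ℝ} (hg : Continuous g) :
    IsCompact (Set.range fun z : P.M => g z) := by
  have h := hP.compact.image hg
  rwa [Set.image_eq_range] at h

theorem norm_gradient_le (hP : P.Assumption Lf Lh Lc M₁ M₂) (z : P.M) :
    ‖gradient P.f z‖ ≤ ⨆ z : P.M, ‖gradient P.f z‖ :=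
  le_ciSup (hP.isCompact_range
    (continuous_of_norm_sub_le hP.Lf_pos.le hP.f_lip).norm).bddAbove z

theorem norm_B_le (hP : P.Assumption Lf Lh Lc M₁ M₂) (z : P.M) : ‖P.B z‖ ≤ P.supGradC :=
  le_ciSup (hP.isCompact_range
    (continuous_of_norm_sub_le hP.Lc_pos.le hP.c_lip).norm).bddAbove z

theorem continuous_F (hP : P.Assumption Lf Lh Lc M₁ M₂) : Continuous P.F :=
  hP.f_smooth.continuous.add (hP.continuous_h.comp hP.c_smooth.continuous)

theorem Fstar_le (hP : P.Assumption Lf Lh Lc M₁ M₂) (z : P.M) : P.Fstar ≤ P.F z :=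
  ciInf_le (hP.isCompact_range hP.continuous_F).bddBelow z

theorem F_le_iSup (hP : P.Assumption Lf Lh Lc M₁ M₂) (z : P.M) : P.F z ≤ ⨆ z : P.M, P.F z :=
  le_ciSup (hP.isCompact_range hP.continuous_F).bddAbove z

theorem GF_nonneg (hP : P.Assumption Lf Lh Lc M₁ M₂) : 0 ≤ P.GF Lh :=
  add_nonneg (Real.iSup_nonneg fun _ => norm_nonneg _)
    (mul_nonneg hP.Lh_pos.le (Real.iSup_nonneg fun _ => norm_nonneg _))

/-- The curvature constant in the model error bound along the retraction. -/
theorem half_curvature_pos (hP : P.Assumption Lf Lh Lc M₁ M₂) :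
    0 < max (M₁ ^ 2) 1 * (Lf + Lh * Lc) / 2 + P.GF Lh * M₂ := by
  have := hP.GF_nonneg
  have := hP.Lf_pos
  have := hP.Lh_pos
  have := hP.Lc_pos
  have := hP.M₂_pos
  have : 0 < max (M₁ ^ 2) 1 := lt_max_of_lt_right one_pos
  positivity

/-- The displacement is `ξ + e` with `‖e‖ ≤ M₂ ‖ξ‖²`. Taylor errors of `f` and `c` along it give the
`L` term; the first-order effect of `e` gives the `G_F M₂` term. -/
theorem F_retr_le (hP : P.Assumption Lf Lh Lc M₁ M₂) (z : P.M) (ξ : P.T z) :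
    P.F (P.retr z ξ) ≤ P.Flin ((z : E n) + ξ) z
      + (max (M₁ ^ 2) 1 * (Lf + Lh * Lc) / 2 + P.GF Lh * M₂) * ‖ξ‖ ^ 2 := by
  set w : E n := ((P.retr z ξ : P.M) : E n)
  set e : E n := w - ((z : E n) + ξ)
  have hLf := hP.Lf_pos
  have hLh := hP.Lh_pos
  have hLc := hP.Lc_pos
  have he : ‖e‖ ≤ M₂ * ‖ξ‖ ^ 2 := hP.retr_bound₂ z ξ
  have hu : ‖w - z‖ ^ 2 ≤ max (M₁ ^ 2) 1 * ‖ξ‖ ^ 2 := by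
    have := pow_le_pow_left₀ (norm_nonneg _) (hP.retr_bound₁ z ξ) 2
    rw [mul_pow] at this
    exact this.trans (by gcongr; exact le_max_left _ _)
  have hwe : w - z = ξ + e := by simp only [e]; abel
  have hf : P.f w ≤ P.f z + ⟪gradient P.f z, (ξ : E n)⟫ + ‖gradient P.f z‖ * ‖e‖
      + Lf / 2 * ‖w - z‖ ^ 2 := by
    have h1 := (le_abs_self _).trans (norm_sub_sub_fderiv_le
      (hP.f_smooth.differentiable one_ne_zero)
      (fun x y => (norm_fderiv_sub_eq P.f x y).trans_le (hP.f_lip x y)) (z : E n) w)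
    rw [← inner_gradient_eq_fderiv] at h1
    have h2 := real_inner_le_norm (gradient P.f z) e
    have h3 : ⟪gradient P.f z, w - z⟫ = ⟪gradient P.f z, (ξ : E n)⟫ + ⟪gradient P.f z, e⟫ := by
      rw [hwe, inner_add_right]
    linarith
  have hc : P.h (P.c w) ≤ P.h (P.c z + P.B z ξ)
      + Lh * (Lc / 2 * ‖w - z‖ ^ 2 + ‖P.B z‖ * ‖e‖) := by
    have h1 := norm_sub_sub_fderiv_le (hP.c_smooth.differentiable one_ne_zero) hP.c_lip (z : E n) w
    have h2 := (le_abs_self _).trans (hP.h_lip (P.c w) (P.c z + P.B z ξ))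
    have h3 : P.c w - (P.c z + P.B z ξ) = (P.c w - P.c z - fderiv ℝ P.c z (w - z)) + P.B z e := by
      rw [hwe, map_add, B]; abel
    have h4 : ‖P.c w - (P.c z + P.B z ξ)‖ ≤ Lc / 2 * ‖w - z‖ ^ 2 + ‖P.B z‖ * ‖e‖ := by
      rw [h3]
      exact (norm_add_le _ _).trans (add_le_add h1 (ContinuousLinearMap.le_opNorm _ _))
    have h5 := mul_le_mul_of_nonneg_left h4 hLh.le
    linarith
  have hG : ‖gradient P.f z‖ + Lh * ‖P.B z‖ ≤ P.GF Lh :=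
    add_le_add (hP.norm_gradient_le z) (mul_le_mul_of_nonneg_left (hP.norm_B_le z) hLh.le)
  have h1 : (‖gradient P.f z‖ + Lh * ‖P.B z‖) * ‖e‖ ≤ P.GF Lh * (M₂ * ‖ξ‖ ^ 2) :=
    mul_le_mul hG he (norm_nonneg _) hP.GF_nonneg
  have h2 : (Lf + Lh * Lc) / 2 * ‖w - z‖ ^ 2
      ≤ (Lf + Lh * Lc) / 2 * (max (M₁ ^ 2) 1 * ‖ξ‖ ^ 2) := by gcongr
  have h3 : P.Flin ((z : E n) + ξ) z
      = P.f z + ⟪gradient P.f z, (ξ : E n)⟫ + P.h (P.c z + P.B z ξ) := by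
    rw [Flin, add_sub_cancel_left, B]
  rw [h3, F]
  linarith

/-! ### The primal subproblem -/

theorem convexOn_Flin (hP : P.Assumption Lf Lh Lc M₁ M₂) (y : E n) :
    ConvexOn ℝ Set.univ fun z => P.Flin z y := by
  refine ⟨convex_univ, fun u _ v _ a b ha hb hab => ?_⟩
  have e : a • u + b • v - y = a • (u - y) + b • (v - y) := by
    obtain rfl : a = 1 - b := by linarith
    module
  have e2 : P.c y + fderiv ℝ P.c y (a • u + b • v - y)
      = a • (P.c y + fderiv ℝ P.c y (u - y)) + b • (P.c y + fderiv ℝ P.c y (v - y)) := by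
    rw [e, map_add, map_smul, map_smul]
    obtain rfl : a = 1 - b := by linarith
    module
  have h := hP.h_convex.2 (Set.mem_univ (P.c y + fderiv ℝ P.c y (u - y)))
    (Set.mem_univ (P.c y + fderiv ℝ P.c y (v - y))) ha hb hab
  simp only [Flin, e2]
  rw [e, inner_add_right, inner_smul_right, inner_smul_right]
  have : P.f y = a * P.f y + b * P.f y := by rw [← add_mul, hab, one_mul]
  simp only [smul_eq_mul] at h ⊢
  linarith

theorem Flin_add_smul_le (hP : P.Assumption Lf Lh Lc M₁ M₂) {α : ℝ} (h0 : 0 ≤ α)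
    (h1 : α ≤ 1) (y v : E n) :
    P.Flin (y + α • v) y ≤ (1 - α) * P.F y + α * P.Flin (v + y) y := by
  have h := (hP.convexOn_Flin y).2 (Set.mem_univ y) (Set.mem_univ (v + y))
    (by linarith : 0 ≤ 1 - α) h0 (by ring)
  rw [show (1 - α) • y + α • (v + y) = y + α • v by module] at h
  simpa [Flin_self] using h

theorem Fprox_growth (hP : P.Assumption Lf Lh Lc M₁ M₂) {s : E n}
    (hs : P.IsProxPoint t z s) {u : E n} (hu : u - z ∈ P.T z) :
    P.Fprox t s z + 1 / (2 * t) * ‖u - s‖ ^ 2 ≤ P.Fprox t u z := by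
  have hconv : Convex ℝ {u : E n | u - z ∈ P.T z} := by
    intro u hu v hv a b _ _ hab
    have e : a • u + b • v - z = a • (u - z) + b • (v - z) := by
      obtain rfl : a = 1 - b := by linarith
      module
    rw [Set.mem_ofPred_eq, e]
    exact add_mem (Submodule.smul_mem _ _ hu) (Submodule.smul_mem _ _ hv)
  have e : 1 / t / 2 = 1 / (2 * t) := by rw [div_div, mul_comm]
  have h := prox_three_point ((hP.convexOn_Flin z).subset (Set.subset_univ _) hconv) (κ := 1 / t)
    (b := (z : E n)) hs.1 hu fun u hu => by
      have := hs.2 u hu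
      simp only [Fprox] at this
      rw [e]; linarith
  simp only [e] at h
  simp only [Fprox]
  linarith

theorem exists_isProxPoint (hP : P.Assumption Lf Lh Lc M₁ M₂) (ht : 0 < t) (z : P.M) :
    ∃ s, P.IsProxPoint t z s := by
  let Ψ : P.T z → ℝ := fun v => P.Fprox t (v + z) z
  have hΨ : Continuous Ψ := by
    have := hP.continuous_h
    simp only [Ψ, Fprox_add]
    fun_prop
  set K := ‖gradient P.f z‖ + Lh * ‖P.B z‖
  -- The linearized part falls at most at rate `K`, so the quadratic dominates beyond radius `2 t
  -- K`.
  have hcoer : ∀ v : P.T z, 2 * t * K ≤ ‖v‖ → Ψ 0 ≤ Ψ v := by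
    intro v hv
    have h1 := neg_le_of_abs_le (abs_real_inner_le_norm (gradient P.f z) (v : E n))
    have h2 := (le_abs_self _).trans (hP.h_lip (P.c z) (P.c z + P.B z v))
    rw [sub_add_cancel_left, norm_neg] at h2
    have h3 := mul_le_mul_of_nonneg_left ((P.B z).le_opNorm v) hP.Lh_pos.le
    have h4 : K * ‖v‖ ≤ 1 / (2 * t) * ‖v‖ ^ 2 := by
      have : 1 / (2 * t) * (2 * t * K * ‖v‖) ≤ 1 / (2 * t) * (‖v‖ * ‖v‖) := by gcongr
      calc K * ‖v‖ = 1 / (2 * t) * (2 * t * K * ‖v‖) := by field_simp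
        _ ≤ _ := by rwa [pow_two]
    have e : ‖(v : E n)‖ = ‖v‖ := rfl
    have h0 : Ψ 0 = P.f z + P.h (P.c z) := by
      simp only [Ψ, Submodule.coe_zero, zero_add, Fprox_self, F]
    rw [h0]
    simp only [Ψ, Fprox_add]
    rw [e] at h1 h3 ⊢
    linarith
  obtain ⟨v, hv⟩ := hΨ.exists_forall_le' 0 <| by
    filter_upwards [(tendsto_norm_cocompact_atTop (E := P.T z)).eventually_ge_atTop (2 * t * K)]
      with v hv using hcoer v hv
  refine ⟨v + z, by simp, fun u hu => ?_⟩
  have h := hv ⟨u - z, hu⟩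
  simpa [Ψ] using h

end Assumption

end CompositeProblem

/-- A duality gap below this multiple of the squared proximal step implies the stopping
criterion. -/
def InexactType.gapRatio : InexactType → ℝ
  | lacc ρ => ρ / (1 + ρ)
  | hacc ρ => ρ / (1 + √ρ) ^ 2

theorem InexactType.gapRatio_pos {it : InexactType} (h : it.Valid) : 0 < it.gapRatio := by
  cases it with
  | lacc ρ =>
    have hρ : 0 < ρ := h
    rw [gapRatio]
    positivity
  | hacc ρ =>
    have hρ : 0 < ρ := h.1
    rw [gapRatio]
    positivity

namespace CompositeProblem

variable {n m d : ℕ} {P : CompositeProblem n m d} {Lf Lh Lc M₁ M₂ t ε : ℝ} {z : P.M}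
  {it : InexactType}

theorem decreaseConst_eq (P : CompositeProblem n m d) (Lf Lh Lc M₁ M₂ t : ℝ) (it : InexactType) :
    P.decreaseConst Lf Lh Lc M₁ M₂ t it = min 1 (it.c₀
      / (2 * (2 * t * (max (M₁ ^ 2) 1 * (Lf + Lh * Lc) / 2 + P.GF Lh * M₂)))) := by
  simp only [decreaseConst, div_inv_eq_mul]
  congr 3
  ring

theorem Assumption.decreaseConst_pos (hP : P.Assumption Lf Lh Lc M₁ M₂) (ht : 0 < t) :
    0 < P.decreaseConst Lf Lh Lc M₁ M₂ t it := by
  have h1 := hP.half_curvature_pos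
  have h2 := it.c₀_pos
  rw [decreaseConst_eq]
  exact lt_min one_pos (by positivity)

/-! ### The line search -/

/-- With `W` the decrease of `Flin` at the full step, convexity gives model decrease at least `α W`,
while the retraction error is at most `α W / 2` by `hα`. The remaining half suffices for both
conditions. -/
theorem Assumption.lineSearchOK (hP : P.Assumption Lf Lh Lc M₁ M₂) {v : P.T z} {α : ℝ}
    (h0 : 0 ≤ α) (h1 : α ≤ 1)
    (hW : it.c₀ * (1 / (2 * t) * ‖v‖ ^ 2) ≤ P.F z - P.Flin ((v : E n) + z) z)
    (hα : α * ((max (M₁ ^ 2) 1 * (Lf + Lh * Lc) / 2 + P.GF Lh * M₂) * ‖v‖ ^ 2)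
      ≤ (P.F z - P.Flin ((v : E n) + z) z) / 2) :
    P.LineSearchOK t it z v α := by
  have hr := hP.F_retr_le z (α • v)
  have hl := hP.Flin_add_smul_le h0 h1 z v
  rw [norm_smul, mul_pow, Real.norm_eq_abs, sq_abs, Submodule.coe_smul] at hr
  have hα' := mul_le_mul_of_nonneg_left hα h0
  refine ⟨?_, by linarith⟩
  have hW' := mul_le_mul_of_nonneg_left hW h0
  have e : it.c₀ * α / (4 * t) * ‖v‖ ^ 2 = α * (it.c₀ * (1 / (2 * t) * ‖v‖ ^ 2)) / 2 := by
    rw [show 4 * t = 2 * t * 2 by ring, div_mul_eq_div_div]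
    ring
  rw [ge_iff_le, e]
  linarith

theorem Assumption.exists_accepts (hP : P.Assumption Lf Lh Lc M₁ M₂) (ht : 0 < t) {v : P.T z}
    (hW : it.c₀ * (1 / (2 * t) * ‖v‖ ^ 2) ≤ P.F z - P.Flin ((v : E n) + z) z) :
    ∃ s, P.Accepts t it z v s := by
  set K := max (M₁ ^ 2) 1 * (Lf + Lh * Lc) / 2 + P.GF Lh * M₂ with hKdef
  have hK : 0 < K := hP.half_curvature_pos
  have hc := it.c₀_pos
  have hne : {s : ℕ | P.LineSearchOK t it z v ((1 / 2) ^ s)}.Nonempty := by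
    obtain ⟨s, hs⟩ := exists_pow_lt_of_lt_one
      (show 0 < it.c₀ * (1 / (2 * t)) / (2 * K) by positivity) (by norm_num : (1 / 2 : ℝ) < 1)
    refine ⟨s, hP.lineSearchOK (by positivity) (pow_le_one₀ (by norm_num) (by norm_num)) hW ?_⟩
    rw [← hKdef]
    calc (1 / 2 : ℝ) ^ s * (K * ‖v‖ ^ 2)
        ≤ it.c₀ * (1 / (2 * t)) / (2 * K) * (K * ‖v‖ ^ 2) := by gcongr
      _ = it.c₀ * (1 / (2 * t) * ‖v‖ ^ 2) / 2 := by field_simp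
      _ ≤ _ := by linarith
  exact ⟨_, Nat.sInf_mem hne, fun s hs => Nat.sInf_le hs⟩

/-- The second line search condition alone yields a decrease of `α W / 2`. It remains to bound `α W`
below: `W ≥ H` if `α = 1`, and otherwise the rejection of `2α` forces `α` to be large. -/
theorem Assumption.decrease_of_accepts (hP : P.Assumption Lf Lh Lc M₁ M₂) (ht : 0 < t)
    (hit : it.Valid) {v : P.T z} {s : ℕ} (hs : P.Accepts t it z v s)
    (hH : 0 ≤ P.F z - P.Fprox t ((v : E n) + z) z)
    (hW : it.c₀ * (1 / (2 * t) * ‖v‖ ^ 2) ≤ P.F z - P.Flin ((v : E n) + z) z) :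
    P.decreaseConst Lf Lh Lc M₁ M₂ t it / 2 * (P.F z - P.Fprox t ((v : E n) + z) z)
      ≤ P.F z - P.F (P.retr z (((1 / 2 : ℝ) ^ s) • v)) := by
  set H := P.F z - P.Fprox t ((v : E n) + z) z
  set W := P.F z - P.Flin ((v : E n) + z) z with hWdef
  set y := ‖v‖ ^ 2
  have hWH : W = H + 1 / (2 * t) * y := by
    simp only [W, H, y, Fprox, add_sub_cancel_right]
    rw [Submodule.coe_norm]
    ring
  have hy : 0 ≤ 1 / (2 * t) * y := by positivity
  have hα0 : (0 : ℝ) ≤ (1 / 2) ^ s := by positivity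
  have hα1 : ((1 : ℝ) / 2) ^ s ≤ 1 := pow_le_one₀ (by norm_num) (by norm_num)
  have hdec : (1 / 2 : ℝ) ^ s * W / 2 ≤ P.F z - P.F (P.retr z (((1 / 2 : ℝ) ^ s) • v)) := by
    have h2 := hs.1.2
    have hl := hP.Flin_add_smul_le hα0 hα1 z v
    rw [hWdef]
    linarith
  refine le_trans ?_ hdec
  rw [decreaseConst_eq]
  cases s with
  | zero =>
    rw [pow_zero, one_mul]
    have := mul_le_mul_of_nonneg_right (min_le_left 1 (it.c₀
      / (2 * (2 * t * (max (M₁ ^ 2) 1 * (Lf + Lh * Lc) / 2 + P.GF Lh * M₂))))) hH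
    linarith
  | succ s =>
    set K := max (M₁ ^ 2) 1 * (Lf + Lh * Lc) / 2 + P.GF Lh * M₂ with hKdef
    have hK : 0 < K := hP.half_curvature_pos
    have hrej : W / 2 < (1 / 2 : ℝ) ^ s * (K * y) := by
      by_contra! hle
      exact absurd (hs.2 (hP.lineSearchOK (by positivity) (pow_le_one₀ (by norm_num) (by norm_num))
        hW hle)) (by simp)
    set α : ℝ := (1 / 2) ^ (s + 1) with hα
    have hα2 : (1 / 2 : ℝ) ^ s = 2 * α := by rw [hα, pow_succ]; ring
    rw [hα2] at hrej
    have hy0 : 0 < y := by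
      rcases (sq_nonneg ‖v‖).eq_or_lt with h | h
      · have : y = 0 := h.symm
        rw [this] at hrej hWH
        linarith
      · exact h
    have hW0 : 0 ≤ W := by linarith
    have h1 : W * W ≤ W * (4 * (α * (K * y))) := by gcongr; linarith
    -- The arithmetic-geometric mean inequality for `W = H + y / (2t)`; combined with `W < 4 α K y`
    -- the factor `y` cancels, leaving a bound on `α W` in terms of `H`.
    have h2 : 4 * (H * (1 / (2 * t) * y)) ≤ W * W := by
      rw [hWH]; linarith [sq_nonneg (H - 1 / (2 * t) * y)]
    have h3 : H * (1 / (2 * t)) ≤ α * W * K := by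
      refine le_of_mul_le_mul_right ?_ hy0
      linarith
    have hc : it.c₀ / (2 * (2 * t * K)) ≤ 1 / (2 * t) / K := by
      have := InexactType.c₀_le_two hit
      calc it.c₀ / (2 * (2 * t * K)) ≤ 2 / (2 * (2 * t * K)) := by gcongr
        _ = _ := by field_simp
    calc min 1 (it.c₀ / (2 * (2 * t * K))) / 2 * H ≤ 1 / (2 * t) / K / 2 * H := by
          gcongr; exact (min_le_right _ _).trans hc
      _ = H * (1 / (2 * t)) / K / 2 := by ring
      _ ≤ α * W * K / K / 2 := by gcongr
      _ = α * W / 2 := by field_simp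

/-! ### One main iteration -/

theorem criterion_iff {la lerg : E m} (hla : P.conj la < ⊤) :
    P.Stop t it z la lerg ↔
      P.Fprox t ((P.primal t z lerg : E n) + z) z - P.dualVal t z la ≤
        match it with
        | .lacc ρ => ρ * (P.F z - P.Fprox t ((P.primal t z lerg : E n) + z) z)
        | .hacc ρ => ρ / (2 * t) * ‖P.primal t z lerg‖ ^ 2 := by
  unfold Stop
  rw [P.dual_eq_coe z hla, ← EReal.coe_sub, EReal.coe_le_coe_iff]

/-- If the stopping criterion holds, the primal suboptimality is controlled by the decrease. -/
theorem Assumption.gap_le_of_criterion (hP : P.Assumption Lf Lh Lc M₁ M₂) (ht : 0 < t)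
    (hit : it.Valid) {s : E n} (hs : P.IsProxPoint t z s) {la lerg : E m} (hla : P.conj la < ⊤)
    (h : P.Stop t it z la lerg) :
    P.Fprox t ((P.primal t z lerg : E n) + z) z - P.Fprox t s z
      ≤ it.rho * (P.F z - P.Fprox t ((P.primal t z lerg : E n) + z) z) := by
  rw [criterion_iff hla] at h
  set v := P.primal t z lerg
  have hD : P.dualVal t z la ≤ P.Fprox t s z := by
    have := P.dualVal_le_Fprox z ht hla hs.1
    rwa [sub_add_cancel] at this
  cases it with
  | lacc ρ =>
    simp only [InexactType.rho] at h ⊢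
    linarith
  | hacc ρ =>
    simp only [InexactType.rho] at h ⊢
    have hG := hP.Fprox_growth hs (u := (z : E n)) (by simp)
    have hδ := hP.Fprox_growth hs (u := (v : E n) + z) (by simp)
    rw [Fprox_self, norm_sub_rev] at hG
    have e : ρ / (2 * t) * ‖v‖ ^ 2 = ρ * (1 / (2 * t) * ‖(v : E n)‖ ^ 2) := by
      rw [Submodule.coe_norm]; ring
    rw [e] at h
    have := gap_le_of_gap_le_norm_sq (x := (v : E n)) (s := s - z) (k := 1 / (2 * t))
      (G := P.F z - P.Fprox t s z) (δ := P.Fprox t ((v : E n) + z) z - P.Fprox t s z)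
      (by positivity) hit.1 (InexactType.sqrt_lt_half hit.2) (by linarith)
      (by rw [sub_sub_eq_add_sub]; linarith) (by linarith)
    rw [sub_sub_sub_cancel_right] at this
    linarith

/-- A small duality gap, relative to the proximal step, implies the stopping criterion. -/
theorem Assumption.criterion_of_gap_le (hP : P.Assumption Lf Lh Lc M₁ M₂) (ht : 0 < t)
    (hit : it.Valid) {s : E n} (hs : P.IsProxPoint t z s) {la lerg : E m} (hla : P.conj la < ⊤)
    (h : P.Fprox t ((P.primal t z lerg : E n) + z) z - P.dualVal t z la
      ≤ it.gapRatio * (1 / (2 * t) * ‖s - z‖ ^ 2)) :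
    P.Stop t it z la lerg := by
  set v := P.primal t z lerg
  have hD : P.dualVal t z la ≤ P.Fprox t s z := by
    have := P.dualVal_le_Fprox z ht hla hs.1
    rwa [sub_add_cancel] at this
  rw [criterion_iff hla]
  change P.Fprox t ((v : E n) + z) z - _ ≤ _
  cases it with
  | lacc ρ =>
    have hρ : 0 < ρ := hit
    simp only [InexactType.gapRatio] at h ⊢
    have hG := hP.Fprox_growth hs (u := (z : E n)) (by simp)
    rw [Fprox_self, norm_sub_rev] at hG
    rw [div_mul_eq_mul_div, le_div_iff₀ (by positivity)] at h
    have h2 := mul_le_mul_of_nonneg_left hG hρ.le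
    -- Weak duality trades the unknown optimal value for the dual value; this costs one more `ρ`
    -- times the gap, hence the ratio `ρ / (1 + ρ)`.
    have h3 := mul_le_mul_of_nonneg_left hD hρ.le
    linarith
  | hacc ρ =>
    simp only at h ⊢
    rw [InexactType.gapRatio] at h
    have hδ := hP.Fprox_growth hs (u := (v : E n) + z) (by simp)
    have e : ρ / (2 * t) * ‖v‖ ^ 2 = ρ * (1 / (2 * t) * ‖(v : E n)‖ ^ 2) := by
      rw [Submodule.coe_norm]; ring
    rw [e]
    exact gap_le_norm_sq_of_gap_le (s := s - z) (by positivity) hit.1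
      (by rw [sub_sub_eq_add_sub]; linarith) h

theorem lt_norm_of_not_isEpsStationary (ht : 0 < t) (hns : ¬ P.IsEpsStationary t ε z) {s : E n}
    (hs : P.IsProxPoint t z s) : t * ε < ‖s - z‖ := by
  by_contra! h
  refine hns ⟨s, hs, ?_⟩
  rw [norm_smul, norm_sub_rev, Real.norm_of_nonneg (by positivity), one_div_mul_eq_div,
    div_le_iff₀' ht]
  exact h

theorem one_le_jEps (C : ℝ) (it : InexactType) (ε : ℝ) : 1 ≤ P.jEps C it ε := by
  cases it <;> exact le_max_left _ _

/-- The bound `j_ε` on the iterations of the dual solver makes the duality gap small. -/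
theorem gap_bound_of_jEps_le (hε : 0 < ε) (ht : 0 < t) (hit : it.Valid) {x : ℝ}
    (hx : P.jEps 2 it ε ≤ x) :
    2 * (t * P.supGradC ^ 2 * P.conjDiam ^ 2) / x ^ 2
      ≤ it.gapRatio * (t / 2 * ε ^ 2) := by
  have key : ∀ R Q : ℝ, 0 < R → R * Q = 4 * (P.supGradC ^ 2 * P.conjDiam ^ 2) →
      1 ≤ x → 1 / ε * √Q ≤ x →
      2 * (t * P.supGradC ^ 2 * P.conjDiam ^ 2) / x ^ 2 ≤ R * (t / 2 * ε ^ 2) := by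
    intro R Q hR hQ h1 h2
    have hQ0 : 0 ≤ Q := by
      refine nonneg_of_mul_nonneg_right ?_ hR
      rw [hQ]; positivity
    rw [one_div_mul_eq_div, div_le_iff₀ hε] at h2
    have h3 := pow_le_pow_left₀ (Real.sqrt_nonneg Q) h2 2
    rw [Real.sq_sqrt hQ0, mul_pow] at h3
    rw [div_le_iff₀ (by positivity)]
    have h4 := mul_le_mul_of_nonneg_left h3 (by positivity : 0 ≤ t / 2 * R)
    have h5 : t / 2 * R * Q = 2 * (t * P.supGradC ^ 2 * P.conjDiam ^ 2) := by
      rw [mul_assoc, hQ]; ring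
    linarith
  cases it with
  | lacc ρ =>
    have hρ : 0 < ρ := hit
    exact key _ _ (InexactType.gapRatio_pos hit)
      (by rw [InexactType.gapRatio]; field_simp; ring) ((le_max_left _ _).trans hx) ((le_max_right _ _).trans hx)
  | hacc ρ =>
    have hρ : 0 < ρ := hit.1
    have : 0 < 1 + √ρ := by positivity
    exact key _ _ (InexactType.gapRatio_pos hit)
      (by rw [InexactType.gapRatio]; field_simp; ring) ((le_max_left _ _).trans hx) ((le_max_right _ _).trans hx)

theorem Assumption.exists_stopsAfter (hP : P.Assumption Lf Lh Lc M₁ M₂) (ht : 0 < t)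
    (hit : it.Valid) (hε : 0 < ε) (hns : ¬ P.IsEpsStationary t ε z) {la lb lc : ℕ → E m}
    (h : P.IsAPG t z la lb lc) :
    ∃ J, P.StopsAfter t it z la lc J ∧ J ≤ ⌊P.jEps 2 it ε⌋₊ := by
  obtain ⟨s, hs⟩ := hP.exists_isProxPoint ht z
  have hsn := lt_norm_of_not_isEpsStationary ht hns hs
  obtain ⟨j, hj⟩ : ∃ j, ⌊P.jEps 2 it ε⌋₊ = j + 1 :=
    Nat.exists_eq_add_of_le' (Nat.le_floor (by simpa using one_le_jEps 2 it ε))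
  -- The rate has `j + 2` after `j + 1` iterations; this extra unit allows `j_ε` to be rounded down.
  have hlt : P.jEps 2 it ε ≤ (j : ℝ) + 2 := by
    have := (Nat.lt_floor_add_one (P.jEps 2 it ε)).le
    rw [hj] at this
    push_cast at this
    linarith
  have hcrit : P.Stop t it z (la (j + 1)) (erg lc (j + 1)) := by
    refine hP.criterion_of_gap_le ht hit hs (h.conj_la_lt_top _) ((h.gap_le hP ht j).trans ?_)
    have hH : ‖P.dualHess z‖ ≤ P.supGradC ^ 2 :=
      (P.norm_dualHess_le z).trans (pow_le_pow_left₀ (norm_nonneg _) (hP.norm_B_le z) 2)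
    have hε2 : t / 2 * ε ^ 2 ≤ 1 / (2 * t) * ‖s - z‖ ^ 2 := by
      have := pow_le_pow_left₀ (by positivity) hsn.le 2
      calc t / 2 * ε ^ 2 = 1 / (2 * t) * (t * ε) ^ 2 := by field_simp
        _ ≤ _ := by gcongr
    calc 2 * (t * ‖P.dualHess z‖ * P.conjDiam ^ 2) / ((j : ℝ) + 2) ^ 2
        ≤ 2 * (t * P.supGradC ^ 2 * P.conjDiam ^ 2) / ((j : ℝ) + 2) ^ 2 := by gcongr
      _ ≤ _ := gap_bound_of_jEps_le hε ht hit hlt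
      _ ≤ _ := mul_le_mul_of_nonneg_left hε2 (InexactType.gapRatio_pos hit).le
  have hmem : j + 1 ∈ {j | 1 ≤ j ∧ P.Stop t it z (la j) (erg lc j)} := ⟨by omega, hcrit⟩
  exact ⟨_, ⟨Nat.sInf_mem ⟨_, hmem⟩, fun i hi => Nat.sInf_le hi⟩, hj ▸ Nat.sInf_le hmem⟩

theorem Assumption.lineSearch_of_criterion (hP : P.Assumption Lf Lh Lc M₁ M₂) (ht : 0 < t)
    (hit : it.Valid) (hε : 0 < ε) (hns : ¬ P.IsEpsStationary t ε z) {la lerg : E m}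
    (hla : P.conj la < ⊤) (h : P.Stop t it z la lerg) :
    (∃ s, P.Accepts t it z (P.primal t z lerg) s) ∧
    ∀ s, P.Accepts t it z (P.primal t z lerg) s →
      t * P.decreaseConst Lf Lh Lc M₁ M₂ t it * ε ^ 2 / (4 + 4 * it.rho)
        ≤ P.F z - P.F (P.retr z (((1 / 2 : ℝ) ^ s) • P.primal t z lerg)) := by
  obtain ⟨s, hs⟩ := hP.exists_isProxPoint ht z
  have hsn := lt_norm_of_not_isEpsStationary ht hns hs
  have hρ := InexactType.rho_pos hit
  have hgap := hP.gap_le_of_criterion ht hit hs hla h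
  set v := P.primal t z lerg
  have hG := hP.Fprox_growth hs (u := (z : E n)) (by simp)
  have hδ := hP.Fprox_growth hs (u := (v : E n) + z) (by simp)
  rw [Fprox_self, norm_sub_rev] at hG
  have hx := norm_sq_le_of_gap_le (x := (v : E n)) (s := s - z) (k := 1 / (2 * t))
    (G := P.F z - P.Fprox t s z) (δ := P.Fprox t ((v : E n) + z) z - P.Fprox t s z)
    (by positivity) hρ (by linarith) (by rw [sub_sub_eq_add_sub]; linarith)
    (by rw [sub_sub_sub_cancel_right]; exact hgap)
  rw [sub_sub_sub_cancel_right] at hx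
  have hH : 1 / (2 * t) * ‖s - z‖ ^ 2 / (1 + it.rho) ≤ P.F z - P.Fprox t ((v : E n) + z) z := by
    rw [div_le_iff₀ (by positivity)]
    linarith
  have hH0 : 0 ≤ P.F z - P.Fprox t ((v : E n) + z) z := le_trans (by positivity) hH
  have hW : it.c₀ * (1 / (2 * t) * ‖v‖ ^ 2) ≤ P.F z - P.Flin ((v : E n) + z) z := by
    have h1 := InexactType.c₀_mul_le hit hx
    have h2 : P.Fprox t ((v : E n) + z) z
        = P.Flin ((v : E n) + z) z + 1 / (2 * t) * ‖(v : E n)‖ ^ 2 := by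
      rw [Fprox, add_sub_cancel_right]
    rw [Submodule.coe_norm]
    linarith
  refine ⟨hP.exists_accepts ht hW, fun r hr => ?_⟩
  refine le_trans ?_ (hP.decrease_of_accepts ht hit hr hH0 hW)
  have hc := hP.decreaseConst_pos (it := it) ht
  have hsq := pow_le_pow_left₀ (by positivity) hsn.le 2
  calc t * P.decreaseConst Lf Lh Lc M₁ M₂ t it * ε ^ 2 / (4 + 4 * it.rho)
      = P.decreaseConst Lf Lh Lc M₁ M₂ t it / 2
          * (1 / (2 * t) * (t * ε) ^ 2 / (1 + it.rho)) := by field_simp; ring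
    _ ≤ P.decreaseConst Lf Lh Lc M₁ M₂ t it / 2
          * (1 / (2 * t) * ‖s - z‖ ^ 2 / (1 + it.rho)) := by gcongr
    _ ≤ _ := by gcongr

/-! ### Total complexity -/

theorem Assumption.exists_totalSubIterations (hP : P.Assumption Lf Lh Lc M₁ M₂) (ht : 0 < t)
    (hit : it.Valid) {z : ℕ → P.M} {la lb lc : ℕ → ℕ → E m} (hrun : P.IsRun t it z la lb lc)
    (hε : 0 < ε) :
    ∃ N : ℕ, P.TotalSubIterations t it z la lc ε N ∧
      N ≤ ⌊(4 + 4 * it.rho) * (P.F (z 0) - P.Fstar)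
            / (t * P.decreaseConst Lf Lh Lc M₁ M₂ t it * ε ^ 2)⌋₊ * ⌊P.jEps 2 it ε⌋₊ := by
  have hρ := InexactType.rho_pos hit
  have hc := hP.decreaseConst_pos (it := it) ht
  set ĉ := P.decreaseConst Lf Lh Lc M₁ M₂ t it
  set A := (4 + 4 * it.rho) * (P.F (z 0) - P.Fstar) / (t * ĉ * ε ^ 2) with hA
  set Δ := t * ĉ * ε ^ 2 / (4 + 4 * it.rho) with hΔ
  have hΔ0 : 0 < Δ := by positivity
  have hdesc : ∀ k, ¬ P.IsEpsStationary t ε (z k) → Δ ≤ P.F (z k) - P.F (z (k + 1)) := by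
    intro k hk
    obtain ⟨J, hJ, -⟩ := hP.exists_stopsAfter ht hit hε hk (hrun.apg k)
    obtain ⟨⟨s, hs⟩, h⟩ := hP.lineSearch_of_criterion ht hit hε hk ((hrun.apg k).conj_la_lt_top J)
      hJ.1.2
    rw [hrun.update k J s hJ hs]
    exact h s hs
  -- This gives both the existence of a stationary iterate and the bound on the index of the first
  -- one.
  have hcount : ∀ K : ℕ, (∀ k < K, ¬ P.IsEpsStationary t ε (z k)) → K ≤ ⌊A⌋₊ := by
    intro K hK
    have hsum : ∑ k ∈ Finset.range K, Δ
        ≤ ∑ k ∈ Finset.range K, (P.F (z k) - P.F (z (k + 1))) :=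
      Finset.sum_le_sum fun k hk => hdesc k (hK k (Finset.mem_range.1 hk))
    rw [Finset.sum_range_sub' (fun k => P.F (z k)), Finset.sum_const, Finset.card_range,
      nsmul_eq_mul] at hsum
    have hF := hP.Fstar_le (z K)
    refine Nat.le_floor ?_
    have e : A = (P.F (z 0) - P.Fstar) / Δ := by
      rw [hA, hΔ, div_div_eq_mul_div, mul_comm (4 + 4 * it.rho)]
    rw [e, le_div_iff₀ hΔ0]
    linarith
  have hne : {k | P.IsEpsStationary t ε (z k)}.Nonempty := by
    by_contra hemp
    rw [Set.not_nonempty_iff_eq_empty, Set.eq_empty_iff_forall_notMem] at hemp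
    exact absurd (hcount (⌊A⌋₊ + 1) fun k _ => hemp k) (by omega)
  set K := sInf {k | P.IsEpsStationary t ε (z k)}
  have hlt : ∀ k < K, ¬ P.IsEpsStationary t ε (z k) := fun k hk => Nat.notMem_of_lt_sInf hk
  choose! J hJ using fun k (hk : k < K) =>
    hP.exists_stopsAfter ht hit hε (hlt k hk) (hrun.apg k)
  refine ⟨_, ⟨K, J, ⟨Nat.sInf_mem hne, fun k hk => Nat.sInf_le hk⟩,
    fun k hk => ⟨(hJ k hk).1, (hP.lineSearch_of_criterion ht hit hε (hlt k hk)
      ((hrun.apg k).conj_la_lt_top _) (hJ k hk).1.1.2).1⟩, rfl⟩, ?_⟩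
  calc ∑ k ∈ Finset.range K, J k ≤ K * ⌊P.jEps 2 it ε⌋₊ := by
        simpa using Finset.sum_le_card_nsmul (Finset.range K) J _
          fun k hk => (hJ k (Finset.mem_range.1 hk)).2
    _ ≤ _ := Nat.mul_le_mul_right _ (hcount K hlt)

theorem exists_jEps_le (P : CompositeProblem n m d) (C : ℝ) (it : InexactType) :
    ∃ a : ℝ, 0 ≤ a ∧ ∀ ε : ℝ, 0 < ε → ε ≤ 1 → P.jEps C it ε ≤ a * (1 / ε) := by
  have key : ∀ b : ℝ, 0 ≤ b → ∀ ε : ℝ, 0 < ε → ε ≤ 1 → max 1 (1 / ε * b) ≤ (1 + b) * (1 / ε) := by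
    intro b hb ε hε hε1
    have h1 : 1 ≤ 1 / ε := by rwa [one_le_div hε]
    have h2 : 0 ≤ 1 / ε * b := by positivity
    exact max_le (by linarith) (by linarith)
  cases it with
  | lacc ρ => exact ⟨_, by positivity, key _ (Real.sqrt_nonneg _)⟩
  | hacc ρ => exact ⟨_, by positivity, key _ (Real.sqrt_nonneg _)⟩

theorem isBigO_jEps (P : CompositeProblem n m d) (C : ℝ) (it : InexactType) :
    Asymptotics.IsBigO (nhdsWithin 0 (Set.Ioi 0)) (P.jEps C it) (fun ε : ℝ => 1 / ε) := by
  obtain ⟨a, ha, h⟩ := P.exists_jEps_le C it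
  refine Asymptotics.IsBigO.of_bound a ?_
  filter_upwards [Ioo_mem_nhdsGT (zero_lt_one' ℝ)] with ε hε
  have h1 : 0 ≤ P.jEps C it ε := zero_le_one.trans (one_le_jEps C it ε)
  have h2 : 0 ≤ 1 / ε := one_div_nonneg.2 hε.1.le
  rw [Real.norm_of_nonneg h1, Real.norm_of_nonneg h2]
  exact h ε hε.1 hε.2.le

theorem Assumption.exists_uniform_bound (hP : P.Assumption Lf Lh Lc M₁ M₂) (ht : 0 < t)
    (hit : it.Valid) :
    ∃ K : ℝ, ∀ (z : ℕ → P.M) (la lb lc : ℕ → ℕ → E m), P.IsRun t it z la lb lc →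
      ∀ ε : ℝ, 0 < ε → ε ≤ 1 →
      ∃ N : ℕ, P.TotalSubIterations t it z la lc ε N ∧ (N : ℝ) ≤ K / ε ^ 3 := by
  obtain ⟨a, ha, hj⟩ := P.exists_jEps_le 2 it
  have hρ := InexactType.rho_pos hit
  have hc := hP.decreaseConst_pos (it := it) ht
  set ĉ := P.decreaseConst Lf Lh Lc M₁ M₂ t it
  -- Replacing `F(z₀)` by the supremum of `F`, finite by compactness, removes the dependence on the
  -- starting point.
  refine ⟨(4 + 4 * it.rho) * ((⨆ z : P.M, P.F z) - P.Fstar) / (t * ĉ) * a,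
    fun z la lb lc hrun ε hε hε1 => ?_⟩
  obtain ⟨N, hN, hle⟩ := hP.exists_totalSubIterations ht hit hrun hε
  refine ⟨N, hN, ?_⟩
  have hF0 : 0 ≤ P.F (z 0) - P.Fstar := sub_nonneg.2 (hP.Fstar_le (z 0))
  have hF1 := hP.F_le_iSup (z 0)
  have h1 : (⌊(4 + 4 * it.rho) * (P.F (z 0) - P.Fstar) / (t * ĉ * ε ^ 2)⌋₊ : ℝ)
      ≤ (4 + 4 * it.rho) * ((⨆ z : P.M, P.F z) - P.Fstar) / (t * ĉ * ε ^ 2) :=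
    (Nat.floor_le (by positivity)).trans (by gcongr)
  have h2 : (⌊P.jEps 2 it ε⌋₊ : ℝ) ≤ a * (1 / ε) :=
    (Nat.floor_le (zero_le_one.trans (one_le_jEps 2 it ε))).trans (hj ε hε hε1)
  calc (N : ℝ) ≤ ((_ * _ : ℕ) : ℝ) := Nat.cast_le.2 hle
    _ ≤ (4 + 4 * it.rho) * ((⨆ z : P.M, P.F z) - P.Fstar) / (t * ĉ * ε ^ 2) * (a * (1 / ε)) := by
        rw [Nat.cast_mul]
        exact mul_le_mul h1 h2 (Nat.cast_nonneg _) ((Nat.cast_nonneg _).trans h1)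
    _ = _ := by field_simp

end CompositeProblem

end IManPL

end

theorem mainTheorem4 :
    -- `C` is a numerical constant
    ∃ C : ℝ, 0 < C ∧
    ∀ (n m d : ℕ) (P : IManPL.CompositeProblem n m d) (Lf Lh Lc M₁ M₂ : ℝ),
    P.Assumption Lf Lh Lc M₁ M₂ →
    ∀ (t : ℝ), 0 < t →
    ∀ (it : IManPL.InexactType), it.Valid →
    -- the explicit bound on the total number of subproblem iterations
    (∀ (z : ℕ → P.M) (la lb lc : ℕ → ℕ → IManPL.E m), P.IsRun t it z la lb lc →
      ∀ ε : ℝ, 0 < ε →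
      ∃ N : ℕ, P.TotalSubIterations t it z la lc ε N ∧
        N ≤ ⌊(4 + 4 * it.rho) * (P.F (z 0) - P.Fstar)
              / (t * P.decreaseConst Lf Lh Lc M₁ M₂ t it * ε ^ 2)⌋₊
            * ⌊P.jEps C it ε⌋₊) ∧
    -- `j_ε = O(1/ε)`
    Asymptotics.IsBigO (nhdsWithin 0 (Set.Ioi 0)) (P.jEps C it) (fun ε : ℝ => 1 / ε) ∧
    -- the total number is `O(1/ε³)`, uniformly over all runs
    (∃ K : ℝ, ∀ (z : ℕ → P.M) (la lb lc : ℕ → ℕ → IManPL.E m), P.IsRun t it z la lb lc →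
      ∀ ε : ℝ, 0 < ε → ε ≤ 1 →
      ∃ N : ℕ, P.TotalSubIterations t it z la lc ε N ∧ (N : ℝ) ≤ K / ε ^ 3) := by
  -- `C = 2` is the numerator constant of the rate in `IsAPG.gap_le`.
  refine ⟨2, two_pos, fun n m d P Lf Lh Lc M₁ M₂ hP t ht it hit => ⟨?_, ?_, ?_⟩⟩
  · exact fun z la lb lc hrun ε hε => hP.exists_totalSubIterations ht hit hrun hε
  · exact P.isBigO_jEps 2 it
  · exact hP.exists_uniform_bound ht hit
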